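/- Let $n\ge 2$ and let $\mathcal{C}\ell(n)$ be the real Clifford algebra of Euclidean $\mathbb{R}^n$, with $e_ie_j+e_je_i=-2\delta_{ij}$ and norm $|a|=(\sum_A a_A^2)^{1/2}$ for $a=\sum_A a_Ae_A$. Let $\Omega\subset\mathbb{R}^n$ be a Jordan domain with boundary $\mathcal{S}$, i.e. $\Omega$ is a bounded, nonempty, connected open set whose topological boundary $\mathcal{S}=\partial\Omega$ is a compact topological hypersurface (a compact set that is locally homeomorphic to $\mathbb{R}^{n-1}$). Put $\Omega^+=\Omega$ and $\Omega^-=\mathbb{R}^n\setminus(\Omega\cup\mathcal{S})$, choose $r$ with $\mathcal{S}\subset\{|x|<r\}$, and put $\Omega^*=\Omega^-\cap\{|x|<r\}$. The Marcinkiewicz exponent of $\mathcal{S}$ is $\mathfrak{m}(\mathcal{S})=\max\{\mathfrak{m}^+(\mathcal{S}),\mathfrak{m}^-(\mathcal{S})\}$, where $$\mathfrak{m}^+(\mathcal{S})=\sup\Big\{p\in\mathbb{R}:\int_{\Omega^+}\frac{dx}{\operatorname{dist}(x,\mathcal{S})^p}<\infty\Big\},\qquad \mathfrak{m}^-(\mathcal{S})=\sup\Big\{p\in\mathbb{R}:\int_{\Omega^*}\frac{dx}{\operatorname{dist}(x,\mathcal{S})^p}<\infty\Big\}.$$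 Let $0<\nu\le 1$ and let $g:\mathcal{S}\to\mathcal{C}\ell(n)$ be Hölder continuous with exponent $\nu$, i.e. $|g(x)-g(y)|\le M|x-y|^\nu$ on $\mathcal{S}$ for some $M$. If $$\nu>1-\frac{\mathfrak{m}(\mathcal{S})}{n},$$ then the scalar additive jump problem is solvable: for every constant $c\in\mathcal{C}\ell(n)$ there is a function $\Phi:\mathbb{R}^n\to\mathcal{C}\ell(n)$ (whose values on $\mathcal{S}$ play no role) that is left monogenic on $\mathbb{R}^n\setminus\mathcal{S}$, i.e. $\Phi$ is of class $C^1$ there and $\sum_{j=1}^n e_j\,\partial\Phi/\partial x^j=0$, that extends continuously from $\Omega^+$ and from $\Omega^-$ to $\mathcal{S}$ with boundary values $\Phi^+$ and $\Phi^-$ satisfying $$\Phi^+(x)-\Phi^-(x)=g(x),\qquad x\in\mathcal{S},$$ and for which $\Phi(x)\to c$ as $|x|\to\infty$. -/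

import Mathlib

open scoped NNReal ENNReal Topology

/-- The quadratic form `x ↦ -|x|²` on Euclidean space `ℝⁿ`. -/
noncomputable def cliffordForm (n : ℕ) : QuadraticForm ℝ (EuclideanSpace ℝ (Fin n)) :=
  -(LinearMap.BilinMap.toQuadraticMap (innerₗ (EuclideanSpace ℝ (Fin n))))

theorem cliffordForm_apply (n : ℕ) (x : EuclideanSpace ℝ (Fin n)) :
    cliffordForm n x = -‖x‖ ^ 2 := by
  simp [cliffordForm]

/-- The real Clifford algebra `Cl(n)` of Euclidean `ℝⁿ`, in which `x² = -|x|²` for vectors `x`. -/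
abbrev Cl (n : ℕ) : Type := CliffordAlgebra (cliffordForm n)

/-- The embedded standard basis vector `e_j` in `Cl(n)`. -/
noncomputable def cliffordGen (n : ℕ) (j : Fin n) : Cl n :=
  CliffordAlgebra.ι (cliffordForm n) (EuclideanSpace.single j 1)

/-- The element `e_A = e_{β₁} ⋯ e_{β_k}` for `A = {β₁ < ⋯ < β_k}`. -/
noncomputable def cliffordBlade (n : ℕ) (A : Finset (Fin n)) : Cl n :=
  ((A.sort (· ≤ ·)).map (cliffordGen n)).prod

/-- The linear basis of `Cl(n)` that corresponds to the standard basis of the exterior algebra of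
`ℝⁿ`; `bladeBasis_apply` identifies its elements with the products `e_A`. -/
noncomputable def bladeBasis (n : ℕ) : Module.Basis (Finset (Fin n)) ℝ (Cl n) :=
  (EuclideanSpace.basisFun (Fin n) ℝ).toBasis.ExteriorAlgebra.map
    (CliffordAlgebra.equivExterior (cliffordForm n)).symm

theorem contractLeft_list_prod_eq_zero {M : Type*} [AddCommGroup M] [Module ℝ M]
    (Q : QuadraticForm ℝ M) (d : Module.Dual ℝ M) (l : List M) (h : ∀ v ∈ l, d v = 0) :
    CliffordAlgebra.contractLeft d ((l.map (CliffordAlgebra.ι Q)).prod) = 0 := by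
  induction l with
  | nil => simp
  | cons v l ih =>
    rw [List.map_cons, List.prod_cons, CliffordAlgebra.contractLeft_ι_mul,
      h v (by simp), ih (fun w hw => h w (by simp [hw]))]
    simp

theorem changeForm_list_prod {M : Type*} [AddCommGroup M] [Module ℝ M]
    {Q Q' : QuadraticForm ℝ M} {B : LinearMap.BilinForm ℝ M} (hB : B.toQuadraticMap = Q' - Q)
    (l : List M) (h : l.Pairwise (fun v w => B v w = 0)) :
    CliffordAlgebra.changeForm hB ((l.map (CliffordAlgebra.ι Q)).prod) =
      (l.map (CliffordAlgebra.ι Q')).prod := by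
  induction l with
  | nil => simp
  | cons v l ih =>
    rw [List.pairwise_cons] at h
    rw [List.map_cons, List.prod_cons, CliffordAlgebra.changeForm_ι_mul, ih h.2,
      contractLeft_list_prod_eq_zero _ _ _ h.1]
    simp

theorem bladeBasis_apply (n : ℕ) (A : Finset (Fin n)) : bladeBasis n A = cliffordBlade n A := by
  rw [bladeBasis, Module.Basis.map_apply, LinearEquiv.symm_apply_eq]
  have hE : (EuclideanSpace.basisFun (Fin n) ℝ).toBasis.ExteriorAlgebra A =
      (((A.sort (· ≤ ·)).map (fun j => (EuclideanSpace.single j (1 : ℝ)))).map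
        (CliffordAlgebra.ι (0 : QuadraticForm ℝ (EuclideanSpace ℝ (Fin n))))).prod := by
    rw [ExteriorAlgebra.basis_apply]
    change (ExteriorAlgebra.ιMulti ℝ A.card) _ = _
    rw [ExteriorAlgebra.ιMulti_apply]
    congr 1
    rw [List.map_map]
    apply List.ext_getElem
    · simp
    · intro i h1 h2
      simp [Set.powersetCard.ofFinEmbEquiv_symm_apply, Finset.orderEmbOfFin_apply]
      try rfl
  have hC : cliffordBlade n A =
      (((A.sort (· ≤ ·)).map (fun j => (EuclideanSpace.single j (1 : ℝ)))).map
        (CliffordAlgebra.ι (cliffordForm n))).prod := by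
    rw [cliffordBlade, List.map_map]
    rfl
  rw [hE, hC, CliffordAlgebra.equivExterior, CliffordAlgebra.changeFormEquiv_apply]
  symm
  apply changeForm_list_prod
  rw [List.pairwise_map]
  refine List.Pairwise.imp_of_mem (R := fun a b => a ≠ b) ?_ (A.sort_nodup _)
  intro a b _ _ hab
  have h0 : inner ℝ (EuclideanSpace.single a (1 : ℝ)) (EuclideanSpace.single b (1 : ℝ)) = 0 := by
    simp [EuclideanSpace.inner_single_left, hab]
  have h1 := norm_add_sq_real (EuclideanSpace.single a (1 : ℝ)) (EuclideanSpace.single b (1 : ℝ))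
  rw [h0] at h1
  rw [QuadraticMap.associated_apply, neg_apply, neg_apply,
    neg_apply, cliffordForm_apply, cliffordForm_apply, cliffordForm_apply, h1]
  simp

/-- The coefficients `(a_A)_A` of `a = ∑ a_A e_A`, as a vector of a Euclidean space. -/
noncomputable def cliffordCoord (n : ℕ) : Cl n ≃ₗ[ℝ] EuclideanSpace ℝ (Finset (Fin n)) :=
  (bladeBasis n).equivFun.trans (WithLp.linearEquiv 2 ℝ (Finset (Fin n) → ℝ)).symm

/-- The norm `|a| = (∑ a_A²)^{1/2}` on `Cl(n)`. -/
noncomputable instance instNormedAddCommGroupCl (n : ℕ) : NormedAddCommGroup (Cl n) :=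
  NormedAddCommGroup.induced (Cl n) (EuclideanSpace ℝ (Finset (Fin n)))
    (cliffordCoord n) (cliffordCoord n).injective

noncomputable instance instNormedSpaceCl (n : ℕ) : NormedSpace ℝ (Cl n) :=
  NormedSpace.induced ℝ (Cl n) (EuclideanSpace ℝ (Finset (Fin n))) (cliffordCoord n)

theorem norm_cl_eq (n : ℕ) (a : Cl n) :
    ‖a‖ = Real.sqrt (∑ A, ((bladeBasis n).repr a A) ^ 2) := by
  have h : ‖a‖ = ‖cliffordCoord n a‖ := rfl
  rw [h, EuclideanSpace.norm_eq]
  simp [cliffordCoord]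

/-- The Dirac operator `∂ₙ u = ∑ⱼ eⱼ ∂u/∂xʲ`, acting from the left. -/
noncomputable def diracOp {n : ℕ} (u : EuclideanSpace ℝ (Fin n) → Cl n)
    (x : EuclideanSpace ℝ (Fin n)) : Cl n :=
  ∑ j, cliffordGen n j * fderiv ℝ u x (EuclideanSpace.single j 1)

/-- `u` is (left) monogenic on the open set `U`: it is `C¹` there and `∂ₙ u = 0`. -/
def IsMonogenicOn {n : ℕ} (u : EuclideanSpace ℝ (Fin n) → Cl n)
    (U : Set (EuclideanSpace ℝ (Fin n))) : Prop :=
  ContDiffOn ℝ 1 u U ∧ ∀ x ∈ U, diracOp u x = 0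

/-- A compact topological hypersurface of `ℝⁿ`: a compact subset which, with the subspace topology,
is locally homeomorphic to `ℝⁿ⁻¹` (for `n ≥ 1`). -/
structure IsCompactHypersurface {n : ℕ} (S : Set (EuclideanSpace ℝ (Fin n))) : Prop where
  isCompact : IsCompact S
  charted : Nonempty (ChartedSpace (EuclideanSpace ℝ (Fin (n - 1))) S)

/-- `Ω` is a Jordan domain with boundary `S`: a bounded domain (nonempty connected open set) whose
topological boundary is the compact topological hypersurface `S`. -/
structure IsJordanDomainWithBoundary {n : ℕ} (Ω S : Set (EuclideanSpace ℝ (Fin n))) : Prop where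
  isOpen : IsOpen Ω
  isConnected : IsConnected Ω
  isBounded : Bornology.IsBounded Ω
  frontier_eq : frontier Ω = S
  hypersurface : IsCompactHypersurface S

/-- The integral `I_p(D) = ∫_D dV(x) / dist(x, S)^p`, with values in `[0, ∞]`. -/
noncomputable def marcinkiewiczIntegral {n : ℕ} (S D : Set (EuclideanSpace ℝ (Fin n))) (p : ℝ) :
    ℝ≥0∞ :=
  ∫⁻ x in D, ENNReal.ofReal (1 / Metric.infDist x S ^ p)

/-- `sup {p : I_p(D) < ∞}`. -/
noncomputable def marcinkiewiczSup {n : ℕ} (S D : Set (EuclideanSpace ℝ (Fin n))) : ℝ :=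
  sSup {p : ℝ | marcinkiewiczIntegral S D p < ∞}

/-- The inner Marcinkiewicz exponent `𝔪⁺(S)` of the boundary `S` of `Ω`. -/
noncomputable def innerMarcinkiewicz {n : ℕ} (Ω S : Set (EuclideanSpace ℝ (Fin n))) : ℝ :=
  marcinkiewiczSup S Ω

/-- The outer Marcinkiewicz exponent `𝔪⁻(S)` of the boundary `S` of `Ω`, computed on
`Ω* = Ω⁻ ∩ {|x| < r}` where `Ω⁻ = ℝⁿ ∖ (Ω ∪ S)`; the radius `r` is to be such that
`S ⊆ {|x| < r}`. -/
noncomputable def outerMarcinkiewicz {n : ℕ} (Ω S : Set (EuclideanSpace ℝ (Fin n))) (r : ℝ) : ℝ :=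
  marcinkiewiczSup S ((Ω ∪ S)ᶜ ∩ Metric.ball 0 r)

/-- The (absolute) Marcinkiewicz exponent `𝔪(S) = max {𝔪⁺(S), 𝔪⁻(S)}`. -/
noncomputable def marcinkiewiczExponent {n : ℕ} (Ω S : Set (EuclideanSpace ℝ (Fin n))) (r : ℝ) :
    ℝ :=
  max (innerMarcinkiewicz Ω S) (outerMarcinkiewicz Ω S r)

/-- `Φ` solves the scalar additive jump problem `Φ⁺ - Φ⁻ = g` on `S`, with `Φ(∞) = c`: it is
monogenic on `ℝⁿ ∖ S`, it extends continuously from `Ω⁺ = Ω` and from `Ω⁻ = ℝⁿ ∖ (Ω ∪ S)` to `S`,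
and the boundary values `Φ⁺`, `Φ⁻` have the jump `g`. -/
structure IsJumpSolution {n : ℕ} (Ω S : Set (EuclideanSpace ℝ (Fin n)))
    (g : EuclideanSpace ℝ (Fin n) → Cl n) (c : Cl n)
    (Φ : EuclideanSpace ℝ (Fin n) → Cl n) : Prop where
  monogenic : IsMonogenicOn Φ Sᶜ
  jump : ∃ Φp Φm : EuclideanSpace ℝ (Fin n) → Cl n,
    ContinuousOn Φp (Ω ∪ S) ∧ Set.EqOn Φp Φ Ω ∧
    ContinuousOn Φm ((Ω ∪ S)ᶜ ∪ S) ∧ Set.EqOn Φm Φ (Ω ∪ S)ᶜ ∧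
    ∀ x ∈ S, Φp x - Φm x = g x
  at_infinity : Filter.Tendsto Φ (Filter.cocompact (EuclideanSpace ℝ (Fin n))) (𝓝 c)

/-!
The jump problem is reduced to a `∂̄`-type correction. Extend the datum `g` from `S` to a compactly
supported function `f`, cut `f` off to one side `U` of `S` (the side that realizes the Marcinkiewicz
exponent), and remove the error of monogenicity `1_U ∂ₙ f` by a Cauchy transform
`T h (x) = ∫ K(x - y) h(y) dy`, where `K(z) = z / |z|^n`: the function `Ψ = 1_U f + κ⁻¹ T (1_U ∇f)`
is monogenic off `S`, its boundary value from `U` exceeds the one from the other side by `g` because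
the Cauchy transform is continuous, and it vanishes at infinity. The solution is `c + Ψ` if `U = Ω` and `c - Ψ` if `U` is the exterior. Since
right multiplication by constants preserves left monogenicity, it is enough to treat real-valued `g`
(`exists_real_jump`) and to sum over the coordinates of `Cl(n)` (`exists_clifford_jump`).

*Extension.* The formula `f(x) = inf_{s ∈ S} (g(s) + M |x - s|^ν)` gives an extension which is
Lipschitz with constant `M δ^(ν - 1)` on `{dist(·, S) ≥ δ}`, because each competitor in the infimum
is (`exists_extension`). So `|∇f| ≤ C dist(·, S)^(ν - 1)`, and the hypothesis on the Marcinkiewicz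
exponent puts `1_U ∇f` into `L^q` for some `q > n` (`isDensity_indicator_gradient`). No smoothness
of `f` beyond local Lipschitz continuity is needed.

*Continuity.* The Cauchy transform of a compactly supported density in `L^q`, `q > n`, is the
locally uniform limit of its regularizations with kernels `z / (|z|² + a)^{n/2}`, by Hölder's inequality and
dominated convergence (`IsDensity.tendstoUniformlyOn_cauchyTransform`).

*Monogenicity.* Near a point off `S` the function `1_U f` coincides with a compactly supported
Lipschitz function `φ`. By the Cauchy–Pompeiu formula `T ∇φ = -κ φ`, which follows from integration
by parts for Lipschitz functions and an approximate identity (`cauchyTransform_zero_gradient`),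
`Ψ` equals `κ⁻¹ T (1_U ∇f - ∇φ)` there, the transform of a density that vanishes near the point;
such a transform is `C¹` and monogenic at that point, as the kernel is away from the origin
(`contDiffAt_cauchyTransform_and_diracOp_eq_zero`).
-/

open MeasureTheory Filter Metric

/-! ### Products of vectors in the Clifford algebra -/

/-- Euclidean space `ℝⁿ`. -/
abbrev Eu (n : ℕ) : Type := EuclideanSpace ℝ (Fin n)

instance finiteDimensional_cl (n : ℕ) : FiniteDimensional ℝ (Cl n) :=
  Module.Finite.of_basis (bladeBasis n)

/-- Multiplication of `Cl(n)` as a continuous bilinear map. -/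
noncomputable def clMul (n : ℕ) : Cl n →L[ℝ] Cl n →L[ℝ] Cl n :=
  LinearMap.toContinuousLinearMap
    ((LinearMap.toContinuousLinearMap (𝕜 := ℝ) (E := Cl n) (F' := Cl n)).toLinearMap ∘ₗ
      LinearMap.mul ℝ (Cl n))

@[simp] theorem clMul_apply {n : ℕ} (a b : Cl n) : clMul n a b = a * b := rfl

/-- The inclusion of vectors into `Cl(n)` as a continuous linear map. -/
noncomputable def vecCl (n : ℕ) : Eu n →L[ℝ] Cl n :=
  LinearMap.toContinuousLinearMap (CliffordAlgebra.ι (cliffordForm n))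

theorem vecCl_single {n : ℕ} (j : Fin n) :
    vecCl n (EuclideanSpace.single j 1) = cliffordGen n j := rfl

theorem vecCl_mul_self {n : ℕ} (x : Eu n) :
    vecCl n x * vecCl n x = algebraMap ℝ (Cl n) (-‖x‖ ^ 2) := by
  rw [← cliffordForm_apply]
  exact CliffordAlgebra.ι_sq_scalar _ _

/-- The product of two vectors in `Cl(n)`, as a continuous bilinear map. -/
noncomputable def vecMul (n : ℕ) : Eu n →L[ℝ] Eu n →L[ℝ] Cl n :=
  (clMul n).bilinearComp (vecCl n) (vecCl n)

@[simp] theorem vecMul_apply {n : ℕ} (x y : Eu n) : vecMul n x y = vecCl n x * vecCl n y := rfl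

theorem vecCl_eq_sum {n : ℕ} (x : Eu n) : vecCl n x = ∑ j, x j • cliffordGen n j := by
  have h := (EuclideanSpace.basisFun (Fin n) ℝ).sum_repr x
  conv_lhs => rw [← h]
  simp [map_sum, vecCl_single]

theorem cliffordGen_mul_self {n : ℕ} (j : Fin n) : cliffordGen n j * cliffordGen n j = -1 := by
  have h := vecCl_mul_self (EuclideanSpace.single j (1 : ℝ))
  simpa [vecCl_single] using h

/-- The derivative of a radial multiple of the identity has the form `v ↦ α v - β ⟨z, v⟩ z`; this
computes the contribution of such a derivative to the Dirac operator. -/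
theorem sum_cliffordGen_mul_vecCl_smul_sub {n : ℕ} (α β : ℝ) (z : Eu n) :
    ∑ j, cliffordGen n j * vecCl n (α • EuclideanSpace.single j 1 - (β * z j) • z) =
      algebraMap ℝ (Cl n) (-(n * α) + β * ‖z‖ ^ 2) := by
  have h : ∀ j, cliffordGen n j * vecCl n (α • EuclideanSpace.single j 1 - (β * z j) • z) =
      algebraMap ℝ (Cl n) (-α) - β • ((z j • cliffordGen n j) * vecCl n z) := by
    intro j
    rw [map_sub, map_smul, map_smul, vecCl_single, mul_sub, mul_smul_comm, cliffordGen_mul_self,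
      mul_smul_comm, smul_mul_assoc, smul_smul, Algebra.algebraMap_eq_smul_one]
    simp
  simp_rw [h]
  rw [Finset.sum_sub_distrib, ← Finset.smul_sum, ← Finset.sum_mul, ← vecCl_eq_sum, vecCl_mul_self]
  simp only [Algebra.algebraMap_eq_smul_one, Finset.sum_const, Finset.card_univ, Fintype.card_fin,
    smul_smul, ← sub_smul, ← Nat.cast_smul_eq_nsmul ℝ]
  congr 1; ring

/-- The analogue of `sum_cliffordGen_mul_vecCl_smul_sub` for the Dirac operator acting from the
right. -/
theorem sum_vecCl_smul_sub_mul_cliffordGen {n : ℕ} (α β : ℝ) (z : Eu n) :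
    ∑ j, vecCl n (α • EuclideanSpace.single j 1 - (β * z j) • z) * cliffordGen n j =
      algebraMap ℝ (Cl n) (-(n * α) + β * ‖z‖ ^ 2) := by
  have h : ∀ j, vecCl n (α • EuclideanSpace.single j 1 - (β * z j) • z) * cliffordGen n j =
      algebraMap ℝ (Cl n) (-α) - β • (vecCl n z * (z j • cliffordGen n j)) := by
    intro j
    rw [map_sub, map_smul, map_smul, vecCl_single, sub_mul, smul_mul_assoc, cliffordGen_mul_self,
      smul_mul_assoc, mul_smul_comm, smul_smul, Algebra.algebraMap_eq_smul_one]
    simp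
  simp_rw [h]
  rw [Finset.sum_sub_distrib, ← Finset.smul_sum, ← Finset.mul_sum, ← vecCl_eq_sum, vecCl_mul_self]
  simp only [Algebra.algebraMap_eq_smul_one, Finset.sum_const, Finset.card_univ, Fintype.card_fin,
    smul_smul, ← sub_smul, ← Nat.cast_smul_eq_nsmul ℝ]
  congr 1; ring

/-! ### The regularized Cauchy kernels -/

/-- The kernel `z / (|z|² + a)^{n/2}`. For `a = 0` this is, up to a constant factor, the Cauchy
kernel of the Dirac operator; for `a > 0` it is a smooth regularization of it. -/
noncomputable def cauchyKernel (n : ℕ) (a : ℝ) (z : Eu n) : Eu n :=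
  (‖z‖ ^ 2 + a) ^ (-(n : ℝ) / 2) • z

theorem hasFDerivAt_cauchyKernel {n : ℕ} {a : ℝ} {z : Eu n} (h : 0 < ‖z‖ ^ 2 + a) :
    HasFDerivAt (cauchyKernel n a)
      ((‖z‖ ^ 2 + a) ^ (-(n : ℝ) / 2) • ContinuousLinearMap.id ℝ (Eu n) +
        ((-(n : ℝ) * (‖z‖ ^ 2 + a) ^ (-(n : ℝ) / 2 - 1)) • innerSL ℝ z).smulRight z) z := by
  have h1 : HasFDerivAt (fun z : Eu n => ‖z‖ ^ 2 + a) (2 • innerSL ℝ z) z :=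
    (hasStrictFDerivAt_norm_sq z).hasFDerivAt.add_const a
  have h2 := h1.rpow_const (p := -(n : ℝ) / 2) (Or.inl h.ne')
  have h3 := h2.smul (hasFDerivAt_id z)
  refine h3.congr_fderiv ?_
  ext v i
  simp
  ring

theorem fderiv_cauchyKernel_apply {n : ℕ} {a : ℝ} {z : Eu n} (h : 0 < ‖z‖ ^ 2 + a) (j : Fin n) :
    fderiv ℝ (cauchyKernel n a) z (EuclideanSpace.single j 1) =
      (‖z‖ ^ 2 + a) ^ (-(n : ℝ) / 2) • EuclideanSpace.single j 1 -
        (n * (‖z‖ ^ 2 + a) ^ (-(n : ℝ) / 2 - 1) * z j) • z := by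
  rw [(hasFDerivAt_cauchyKernel h).fderiv]
  ext i
  simp [EuclideanSpace.inner_single_right]
  ring

theorem contDiffAt_cauchyKernel {n : ℕ} {a : ℝ} {z : Eu n} (h : 0 < ‖z‖ ^ 2 + a) :
    ContDiffAt ℝ 1 (cauchyKernel n a) z := by
  have h1 : ContDiffAt ℝ 1 (fun z : Eu n => ‖z‖ ^ 2 + a) z :=
    (contDiff_norm_sq ℝ).contDiffAt.add contDiffAt_const
  exact (h1.rpow_const_of_ne h.ne').smul contDiffAt_id

theorem cauchyKernel_dirac_scalar {n : ℕ} {s t : ℝ} (hs : 0 < s) :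
    -(n * s ^ (-(n : ℝ) / 2)) + n * s ^ (-(n : ℝ) / 2 - 1) * t =
      -(n * (s - t) * s ^ (-(n : ℝ) / 2 - 1)) := by
  rw [Real.rpow_sub_one hs.ne']
  field_simp
  ring

/-- The Cauchy kernel is left monogenic away from the origin. -/
theorem sum_cliffordGen_mul_fderiv_cauchyKernel {n : ℕ} {z : Eu n} (h : z ≠ 0) :
    ∑ j, cliffordGen n j *
      vecCl n (fderiv ℝ (cauchyKernel n 0) z (EuclideanSpace.single j 1)) = 0 := by
  have hs : 0 < ‖z‖ ^ 2 + 0 := by positivity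
  simp_rw [fderiv_cauchyKernel_apply hs, sum_cliffordGen_mul_vecCl_smul_sub,
    cauchyKernel_dirac_scalar hs]
  simp

/-- The Dirac operator, acting from the right, takes the regularized Cauchy kernel to a scalar
function, a multiple of an approximate identity as `a → 0`. -/
theorem sum_fderiv_cauchyKernel_mul_cliffordGen {n : ℕ} {a : ℝ} (ha : 0 < a) (z : Eu n) :
    ∑ j, vecCl n (fderiv ℝ (cauchyKernel n a) z (EuclideanSpace.single j 1)) * cliffordGen n j =
      algebraMap ℝ (Cl n) (-(n * a * (‖z‖ ^ 2 + a) ^ (-(n : ℝ) / 2 - 1))) := by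
  have hs : 0 < ‖z‖ ^ 2 + a := by positivity
  simp_rw [fderiv_cauchyKernel_apply hs, sum_vecCl_smul_sub_mul_cliffordGen,
    cauchyKernel_dirac_scalar hs]
  simp

theorem norm_cauchyKernel_zero {n : ℕ} {z : Eu n} (h : z ≠ 0) :
    ‖cauchyKernel n 0 z‖ = ‖z‖ ^ (-((n : ℝ) - 1)) := by
  have hz : 0 < ‖z‖ := by positivity
  rw [cauchyKernel, norm_smul, add_zero, Real.norm_of_nonneg (by positivity),
    ← Real.rpow_natCast ‖z‖ 2, ← Real.rpow_mul hz.le]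
  nth_rw 2 [← Real.rpow_one ‖z‖]
  rw [← Real.rpow_add hz]
  congr 1
  push_cast
  ring

/-- The regularized kernel is a multiple, by a factor in `[0, 1]`, of the Cauchy kernel. Hence the
Cauchy kernel dominates both the regularized kernel and its difference from the Cauchy kernel. -/
theorem exists_cauchyKernel_eq_smul {n : ℕ} {a : ℝ} (ha : 0 ≤ a) (z : Eu n) :
    ∃ t ∈ Set.Icc (0 : ℝ) 1, cauchyKernel n a z = t • cauchyKernel n 0 z := by
  rcases eq_or_ne z 0 with rfl | hz
  · exact ⟨0, by simp, by simp [cauchyKernel]⟩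
  have h0 : 0 < ‖z‖ ^ 2 := by positivity
  refine ⟨(‖z‖ ^ 2 + a) ^ (-(n : ℝ) / 2) / (‖z‖ ^ 2) ^ (-(n : ℝ) / 2), ⟨by positivity, ?_⟩, ?_⟩
  · rw [div_le_one (by positivity)]
    apply Real.rpow_le_rpow_of_nonpos h0 (by linarith)
    have : (0 : ℝ) ≤ n := by positivity
    linarith
  · rw [cauchyKernel, cauchyKernel, smul_smul, add_zero, div_mul_cancel₀]
    positivity

theorem norm_cauchyKernel_le {n : ℕ} {a : ℝ} (ha : 0 ≤ a) (z : Eu n) :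
    ‖cauchyKernel n a z‖ ≤ ‖cauchyKernel n 0 z‖ := by
  obtain ⟨t, ⟨h0, h1⟩, h⟩ := exists_cauchyKernel_eq_smul ha z
  rw [h, norm_smul, Real.norm_of_nonneg h0]
  exact mul_le_of_le_one_left (norm_nonneg _) h1

theorem norm_cauchyKernel_sub_le {n : ℕ} {a : ℝ} (ha : 0 ≤ a) (z : Eu n) :
    ‖cauchyKernel n a z - cauchyKernel n 0 z‖ ≤ ‖cauchyKernel n 0 z‖ := by
  obtain ⟨t, ⟨h0, h1⟩, h⟩ := exists_cauchyKernel_eq_smul ha z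
  have : t • cauchyKernel n 0 z - cauchyKernel n 0 z = (t - 1) • cauchyKernel n 0 z := by
    rw [sub_smul, one_smul]
  rw [h, this, norm_smul, Real.norm_eq_abs]
  exact mul_le_of_le_one_left (norm_nonneg _) (abs_le.2 ⟨by linarith, by linarith⟩)

theorem tendsto_cauchyKernel {n : ℕ} (z : Eu n) :
    Tendsto (fun a => cauchyKernel n a z) (𝓝[>] 0) (𝓝 (cauchyKernel n 0 z)) := by
  rcases eq_or_ne z 0 with rfl | hz
  · simp [cauchyKernel]
  have h0 : ‖z‖ ^ 2 + 0 ≠ 0 := by positivity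
  have : ContinuousAt (fun a => cauchyKernel n a z) 0 := by
    unfold cauchyKernel
    exact ((continuousAt_const.add continuousAt_id).rpow_const (Or.inl h0)).smul continuousAt_const
  exact this.tendsto.mono_left nhdsWithin_le_nhds

theorem contDiff_cauchyKernel {n : ℕ} {a : ℝ} (ha : 0 < a) : ContDiff ℝ 1 (cauchyKernel n a) :=
  contDiff_iff_contDiffAt.2 fun _ => contDiffAt_cauchyKernel (by positivity)

theorem measurable_cauchyKernel (n : ℕ) (a : ℝ) : Measurable (cauchyKernel n a) := by
  unfold cauchyKernel
  fun_prop

theorem norm_fderiv_cauchyKernel_le {n : ℕ} {a : ℝ} (ha : 0 < a) (z : Eu n) :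
    ‖fderiv ℝ (cauchyKernel n a) z‖ ≤ (1 + n) * a ^ (-(n : ℝ) / 2) := by
  have hs : 0 < ‖z‖ ^ 2 + a := by positivity
  have hn : -(n : ℝ) / 2 ≤ 0 := by
    have : (0 : ℝ) ≤ n := by positivity
    linarith
  rw [(hasFDerivAt_cauchyKernel hs).fderiv]
  set s := ‖z‖ ^ 2 + a with hsdef
  have h1 : s ^ (-(n : ℝ) / 2) ≤ a ^ (-(n : ℝ) / 2) :=
    Real.rpow_le_rpow_of_nonpos ha (by rw [hsdef]; nlinarith [sq_nonneg ‖z‖]) hn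
  refine (norm_add_le _ _).trans ?_
  rw [add_mul, one_mul, norm_smul, ContinuousLinearMap.norm_smulRight_apply, norm_smul,
    innerSL_apply_norm, Real.norm_of_nonneg (by positivity), norm_mul, norm_neg,
    Real.norm_natCast, Real.norm_of_nonneg (by positivity)]
  refine add_le_add ?_ ?_
  · exact (mul_le_of_le_one_right (by positivity) ContinuousLinearMap.norm_id_le).trans h1
  · rw [mul_assoc, mul_assoc]
    refine mul_le_mul_of_nonneg_left ?_ (by positivity)
    refine le_trans ?_ h1
    rw [Real.rpow_sub_one hs.ne', div_mul_eq_mul_div, div_le_iff₀ hs]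
    refine mul_le_mul_of_nonneg_left ?_ (by positivity)
    rw [hsdef]; nlinarith

theorem exists_lipschitzWith_cauchyKernel {n : ℕ} {a : ℝ} (ha : 0 < a) :
    ∃ C, LipschitzWith C (cauchyKernel n a) :=
  ⟨⟨(1 + n) * a ^ (-(n : ℝ) / 2), by positivity⟩,
    lipschitzWith_of_nnnorm_fderiv_le ((contDiff_cauchyKernel ha).differentiable (by norm_num))
      fun z => norm_fderiv_cauchyKernel_le ha z⟩

/-! ### The Cauchy transform of a density in `L^q`, `q > n` -/

/-- The convolution of the regularized Cauchy kernel with a vector field. -/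
noncomputable def cauchyTransform (n : ℕ) (a : ℝ) (h : Eu n → Eu n) (x : Eu n) : Cl n :=
  ∫ y, vecMul n (cauchyKernel n a (x - y)) (h y)

/-- Measurable vector fields that vanish outside the ball of radius `r` and whose `q`-th power is
integrable. -/
structure IsDensity {n : ℕ} (q r : ℝ) (h : Eu n → Eu n) : Prop where
  measurable : Measurable h
  eq_zero : ∀ y, r ≤ ‖y‖ → h y = 0
  lintegral_lt_top : ∫⁻ y, ‖h y‖ₑ ^ q < ∞

theorem IsDensity.sub {n : ℕ} {q r r' : ℝ} (hq : 1 ≤ q) {h k : Eu n → Eu n}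
    (hh : IsDensity q r h) (hk : IsDensity q r' k) :
    IsDensity q (max r r') (fun y => h y - k y) where
  measurable := hh.measurable.sub hk.measurable
  eq_zero y hy := by
    rw [hh.eq_zero y ((le_max_left _ _).trans hy), hk.eq_zero y ((le_max_right _ _).trans hy),
      sub_zero]
  lintegral_lt_top := by
    have hle : ∀ y, ‖h y - k y‖ₑ ^ q ≤ 2 ^ (q - 1) * (‖h y‖ₑ ^ q + ‖k y‖ₑ ^ q) := fun y =>
      (ENNReal.rpow_le_rpow (enorm_sub_le (E := Eu n)) (by linarith)).trans
        (ENNReal.rpow_add_le_mul_rpow_add_rpow _ _ hq)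
    refine (lintegral_mono hle).trans_lt ?_
    rw [lintegral_const_mul' _ _ (ENNReal.rpow_lt_top_of_nonneg (by linarith) (by simp)).ne,
      lintegral_add_left (hh.measurable.enorm.pow_const q)]
    exact ENNReal.mul_lt_top (ENNReal.rpow_lt_top_of_nonneg (by linarith) (by simp))
      (ENNReal.add_lt_top.2 ⟨hh.lintegral_lt_top, hk.lintegral_lt_top⟩)

theorem IsDensity.of_bounded {n : ℕ} {q r C : ℝ} (hq : 0 < q) {h : Eu n → Eu n}
    (hm : Measurable h) (h0 : ∀ y, r ≤ ‖y‖ → h y = 0) (hC : ∀ y, ‖h y‖ ≤ C) :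
    IsDensity q r h where
  measurable := hm
  eq_zero := h0
  lintegral_lt_top := by
    have hle : ∀ y, ‖h y‖ₑ ^ q ≤
        (ball (0 : Eu n) r).indicator (fun _ => ENNReal.ofReal C ^ q) y := by
      intro y
      by_cases hy : y ∈ ball (0 : Eu n) r
      · rw [Set.indicator_of_mem hy]
        refine ENNReal.rpow_le_rpow ?_ hq.le
        rw [← ofReal_norm]
        exact ENNReal.ofReal_le_ofReal (hC y)
      · rw [h0 y (by simpa using hy)]
        simp [hq]
    refine (lintegral_mono hle).trans_lt ?_
    rw [lintegral_indicator measurableSet_ball, setLIntegral_const]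
    exact ENNReal.mul_lt_top (ENNReal.rpow_lt_top_of_nonneg hq.le (by simp)) measure_ball_lt_top

theorem IsDensity.integrable {n : ℕ} {q r : ℝ} (hq : 1 ≤ q) {h : Eu n → Eu n}
    (hh : IsDensity q r h) : Integrable h := by
  refine ⟨hh.measurable.aestronglyMeasurable, ?_⟩
  have hle : ∀ y, ‖h y‖ₑ ≤ (ball (0 : Eu n) r).indicator (fun _ => 1) y + ‖h y‖ₑ ^ q := by
    intro y
    by_cases hy : y ∈ ball (0 : Eu n) r
    · rw [Set.indicator_of_mem hy]
      rcases le_total ‖h y‖ₑ 1 with h1 | h1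
      · exact h1.trans le_self_add
      · refine le_trans ?_ le_add_self
        simpa using ENNReal.rpow_le_rpow_of_exponent_le h1 hq
    · rw [hh.eq_zero y (by simpa using hy)]
      simp
  refine (lintegral_mono hle).trans_lt ?_
  rw [lintegral_add_left (measurable_const.indicator measurableSet_ball),
    lintegral_indicator measurableSet_ball, setLIntegral_const, one_mul]
  exact ENNReal.add_lt_top.2 ⟨measure_ball_lt_top, hh.lintegral_lt_top⟩

/-- Hölder's inequality for convolutions with a density. -/
theorem IsDensity.lintegral_conv_le {n : ℕ} {q q' r R : ℝ} (hqq : q'.HolderConjugate q)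
    {h : Eu n → Eu n} (hh : IsDensity q r h) {k : Eu n → Eu n} (hk : Measurable k) {x : Eu n}
    (hx : x ∈ ball (0 : Eu n) R) :
    ∫⁻ y, ‖k (x - y)‖ₑ * ‖h y‖ₑ ≤
      (∫⁻ z in ball (0 : Eu n) (R + r), ‖k z‖ₑ ^ q') ^ (1 / q') *
        (∫⁻ y, ‖h y‖ₑ ^ q) ^ (1 / q) := by
  set B := ball (0 : Eu n) (R + r)
  have hmeas : Measurable (B.indicator fun z => ‖k z‖ₑ) := hk.enorm.indicator measurableSet_ball
  have h1 : ∀ y, ‖k (x - y)‖ₑ * ‖h y‖ₑ = B.indicator (fun z => ‖k z‖ₑ) (x - y) * ‖h y‖ₑ := by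
    intro y
    by_cases hy : r ≤ ‖y‖
    · simp [hh.eq_zero y hy]
    · have : x - y ∈ B := by
        have hx' : ‖x‖ < R := by simpa using hx
        simp only [B, mem_ball_zero_iff]
        exact (norm_sub_le _ _).trans_lt (by linarith)
      rw [Set.indicator_of_mem this]
  simp_rw [h1]
  refine (ENNReal.lintegral_mul_le_Lp_mul_Lq volume hqq
    (hmeas.comp (measurable_const.sub measurable_id)).aemeasurable
    hh.measurable.enorm.aemeasurable).trans_eq ?_
  congr 2
  have h2 := lintegral_sub_left_eq_self (μ := (volume : Measure (Eu n)))
    (fun z => (B.indicator (fun z => ‖k z‖ₑ) z) ^ q') x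
  rw [← lintegral_indicator measurableSet_ball]
  refine Eq.trans h2 (lintegral_congr fun z => ?_)
  by_cases hz : z ∈ B
  · simp [B, hz]
  · simp [B, hz, hqq.pos]

theorem holderConjugate_of_lt {q : ℝ} (hq : 1 < q) : (q / (q - 1)).HolderConjugate q :=
  (Real.HolderConjugate.conjExponent hq).symm

/-- The Cauchy kernel is locally in `L^{q'}` for the exponent `q' = q / (q - 1)` conjugate to `q`:
`(n - 1) q' < n` amounts to `n < q`. -/
theorem lintegral_cauchyKernel_rpow_lt_top {n : ℕ} (hn : 2 ≤ n) {q : ℝ} (hq : n < q) (R : ℝ) :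
    ∫⁻ z in ball (0 : Eu n) R, ‖cauchyKernel n 0 z‖ₑ ^ (q / (q - 1)) < ∞ := by
  have hn' : (2 : ℝ) ≤ n := by exact_mod_cast hn
  have hq0 : 0 < q / (q - 1) := div_pos (by linarith) (by linarith)
  have hα : ((n : ℝ) - 1) * (q / (q - 1)) < Module.finrank ℝ (Eu n) := by
    rw [finrank_euclideanSpace_fin, mul_div_assoc', div_lt_iff₀ (by linarith)]
    linarith
  have hint : IntegrableOn (fun z => ‖cauchyKernel n 0 z‖ ^ (q / (q - 1))) (ball (0 : Eu n) R) := by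
    refine integrableOn_ball_of_norm_le_rpow (C := 1) (by rw [finrank_euclideanSpace_fin]; omega)
      hα (Eventually.of_forall fun z => ?_)
      ((measurable_cauchyKernel n 0).norm.pow_const _).aestronglyMeasurable
    rw [one_mul, Real.norm_of_nonneg (by positivity)]
    rcases eq_or_ne z 0 with rfl | hz
    · simp only [cauchyKernel, smul_zero, norm_zero]
      rw [Real.zero_rpow hq0.ne']
      exact Real.rpow_nonneg le_rfl _
    · rw [norm_cauchyKernel_zero hz, ← Real.rpow_mul (norm_nonneg _), neg_mul]
  refine lt_of_eq_of_lt (lintegral_congr fun z => ?_) hint.2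
  rw [Real.enorm_rpow_of_nonneg (norm_nonneg _) hq0.le, enorm_norm]

theorem norm_vecMul_le {n : ℕ} (x y : Eu n) : ‖vecMul n x y‖ ≤ ‖vecMul n‖ * ‖x‖ * ‖y‖ :=
  (vecMul n).le_opNorm₂ x y

theorem enorm_vecMul_le {n : ℕ} (x y : Eu n) : ‖vecMul n x y‖ₑ ≤ ‖vecMul n‖ₑ * (‖x‖ₑ * ‖y‖ₑ) := by
  simp only [← ofReal_norm]
  rw [← ENNReal.ofReal_mul (by positivity), ← ENNReal.ofReal_mul (by positivity), ← mul_assoc]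
  exact ENNReal.ofReal_le_ofReal (norm_vecMul_le x y)

theorem aestronglyMeasurable_vecMul {n : ℕ} {k h : Eu n → Eu n} (hk : Measurable k)
    (hh : Measurable h) : AEStronglyMeasurable fun y => vecMul n (k y) (h y) :=
  (vecMul n).aestronglyMeasurable_comp₂ hk.aestronglyMeasurable hh.aestronglyMeasurable

theorem IsDensity.integrable_cauchyKernel {n : ℕ} (hn : 2 ≤ n) {q r : ℝ} (hq : n < q)
    {h : Eu n → Eu n} (hh : IsDensity q r h) {a : ℝ} (ha : 0 ≤ a) (x : Eu n) :
    Integrable fun y => vecMul n (cauchyKernel n a (x - y)) (h y) := by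
  have hn' : (2 : ℝ) ≤ n := by exact_mod_cast hn
  refine ⟨aestronglyMeasurable_vecMul ((measurable_cauchyKernel n a).comp
    (measurable_const.sub measurable_id)) hh.measurable, ?_⟩
  have hle : ∀ y, ‖vecMul n (cauchyKernel n a (x - y)) (h y)‖ₑ ≤
      ‖vecMul n‖ₑ * (‖cauchyKernel n 0 (x - y)‖ₑ * ‖h y‖ₑ) := fun y =>
    (enorm_vecMul_le _ _).trans (mul_le_mul_right (mul_le_mul_left
      (enorm_le_iff_norm_le.2 (norm_cauchyKernel_le ha _)) _) _)
  refine (lintegral_mono hle).trans_lt ?_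
  rw [lintegral_const_mul' _ _ (by simp)]
  refine ENNReal.mul_lt_top (by simp) ((hh.lintegral_conv_le (holderConjugate_of_lt (by linarith))
    (measurable_cauchyKernel n 0) (x := x) (R := ‖x‖ + 1) (by simp)).trans_lt ?_)
  have hq0 : 0 < q / (q - 1) := div_pos (by linarith) (by linarith)
  exact ENNReal.mul_lt_top
    (ENNReal.rpow_lt_top_of_nonneg (by positivity) (lintegral_cauchyKernel_rpow_lt_top hn hq _).ne)
    (ENNReal.rpow_lt_top_of_nonneg (by rw [one_div, inv_nonneg]; linarith) hh.lintegral_lt_top.ne)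

theorem tendsto_lintegral_cauchyKernel_sub {n : ℕ} (hn : 2 ≤ n) {q : ℝ} (hq : n < q) (R : ℝ) :
    Tendsto (fun a => ∫⁻ z in ball (0 : Eu n) R,
      ‖cauchyKernel n a z - cauchyKernel n 0 z‖ₑ ^ (q / (q - 1))) (𝓝[>] 0) (𝓝 0) := by
  have hn' : (2 : ℝ) ≤ n := by exact_mod_cast hn
  have hq0 : 0 < q / (q - 1) := div_pos (by linarith) (by linarith)
  rw [← lintegral_zero (μ := volume.restrict (ball (0 : Eu n) R))]
  refine tendsto_lintegral_filter_of_dominated_convergence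
    (fun z => ‖cauchyKernel n 0 z‖ₑ ^ (q / (q - 1))) ?_ ?_
    (lintegral_cauchyKernel_rpow_lt_top hn hq R).ne ?_
  · exact Eventually.of_forall fun a =>
      ((measurable_cauchyKernel n a).sub (measurable_cauchyKernel n 0)).enorm.pow_const _
  · filter_upwards [self_mem_nhdsWithin] with a ha
    refine Eventually.of_forall fun z => ENNReal.rpow_le_rpow ?_ hq0.le
    exact enorm_le_iff_norm_le.2 (norm_cauchyKernel_sub_le (le_of_lt ha) z)
  · refine Eventually.of_forall fun z => ?_
    have h1 : Tendsto (fun a => ‖cauchyKernel n a z - cauchyKernel n 0 z‖ₑ) (𝓝[>] 0) (𝓝 0) := by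
      have := ((tendsto_cauchyKernel z).sub_const (cauchyKernel n 0 z)).enorm
      simpa using this
    simpa [hq0] using h1.ennrpow_const (q / (q - 1))

/-- The regularized Cauchy transforms of a density converge locally uniformly. -/
theorem IsDensity.tendstoUniformlyOn_cauchyTransform {n : ℕ} (hn : 2 ≤ n) {q r : ℝ} (hq : n < q)
    {h : Eu n → Eu n} (hh : IsDensity q r h) (R : ℝ) :
    TendstoUniformlyOn (fun a => cauchyTransform n a h) (cauchyTransform n 0 h) (𝓝[>] 0)
      (ball 0 R) := by
  have hn' : (2 : ℝ) ≤ n := by exact_mod_cast hn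
  have hq0 : 0 < q / (q - 1) := div_pos (by linarith) (by linarith)
  -- the bound of Hölder's inequality for the distance of the two transforms on the ball
  set δ : ℝ → ℝ≥0∞ := fun a => ‖vecMul n‖ₑ * ((∫⁻ z in ball (0 : Eu n) (R + r),
    ‖cauchyKernel n a z - cauchyKernel n 0 z‖ₑ ^ (q / (q - 1))) ^ (1 / (q / (q - 1))) *
      (∫⁻ y, ‖h y‖ₑ ^ q) ^ (1 / q)) with hδ
  have hlim : Tendsto δ (𝓝[>] 0) (𝓝 0) := by
    have h1 := (tendsto_lintegral_cauchyKernel_sub hn hq (R + r)).ennrpow_const (1 / (q / (q - 1)))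
    rw [ENNReal.zero_rpow_of_pos (by positivity)] at h1
    have h2 := ENNReal.Tendsto.mul_const (b := (∫⁻ y, ‖h y‖ₑ ^ q) ^ (1 / q)) h1
      (Or.inr (ENNReal.rpow_lt_top_of_nonneg (by rw [one_div, inv_nonneg]; linarith)
        hh.lintegral_lt_top.ne).ne)
    have h3 := ENNReal.Tendsto.const_mul (a := ‖vecMul n‖ₑ) h2 (Or.inr (by simp))
    simpa only [mul_zero, zero_mul] using h3
  rw [EMetric.tendstoUniformlyOn_iff]
  intro ε hε
  filter_upwards [hlim.eventually (gt_mem_nhds hε), self_mem_nhdsWithin] with a ha ha0 x hx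
  refine lt_of_le_of_lt ?_ ha
  have ha0' : (0 : ℝ) ≤ a := le_of_lt ha0
  rw [edist_comm, edist_eq_enorm_sub, cauchyTransform, cauchyTransform,
    ← integral_sub (hh.integrable_cauchyKernel hn hq ha0' x)
      (hh.integrable_cauchyKernel hn hq le_rfl x)]
  refine (enorm_integral_le_lintegral_enorm _).trans ?_
  refine (lintegral_mono (g := fun y => ‖vecMul n‖ₑ *
    (‖(fun z => cauchyKernel n a z - cauchyKernel n 0 z) (x - y)‖ₑ * ‖h y‖ₑ)) fun y => ?_).trans ?_
  · have := enorm_vecMul_le (cauchyKernel n a (x - y) - cauchyKernel n 0 (x - y)) (h y)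
    rwa [map_sub, sub_apply] at this
  · rw [lintegral_const_mul' _ _ (by simp), hδ]
    exact mul_le_mul_right (hh.lintegral_conv_le (holderConjugate_of_lt (by linarith))
      ((measurable_cauchyKernel n a).sub (measurable_cauchyKernel n 0)) hx) _

theorem IsDensity.continuous_cauchyTransform_of_pos {n : ℕ} (hn : 2 ≤ n) {q r : ℝ} (hq : n < q)
    {h : Eu n → Eu n} (hh : IsDensity q r h) {a : ℝ} (ha : 0 < a) :
    Continuous (cauchyTransform n a h) := by
  have hn' : (2 : ℝ) ≤ n := by exact_mod_cast hn
  obtain ⟨C, hC⟩ := exists_lipschitzWith_cauchyKernel (n := n) ha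
  have hint := hh.integrable (by linarith)
  refine LipschitzWith.continuous (K := ⟨‖vecMul n‖ * C * ∫ y, ‖h y‖, by positivity⟩)
    (LipschitzWith.of_dist_le_mul fun x x' => ?_)
  rw [dist_eq_norm, dist_eq_norm, cauchyTransform, cauchyTransform,
    ← integral_sub (hh.integrable_cauchyKernel hn hq ha.le x)
      (hh.integrable_cauchyKernel hn hq ha.le x')]
  have hle : ∀ y, ‖vecMul n (cauchyKernel n a (x - y)) (h y) -
      vecMul n (cauchyKernel n a (x' - y)) (h y)‖ ≤ (‖vecMul n‖ * C * ‖x - x'‖) * ‖h y‖ := by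
    intro y
    rw [← sub_apply, ← map_sub]
    refine (norm_vecMul_le _ _).trans ?_
    have h1 := hC.norm_sub_le (x - y) (x' - y)
    rw [sub_sub_sub_cancel_right] at h1
    rw [mul_assoc ‖vecMul n‖ (C : ℝ)]
    exact mul_le_mul_of_nonneg_right (mul_le_mul_of_nonneg_left h1 (by positivity))
      (norm_nonneg _)
  refine (norm_integral_le_of_norm_le (hint.norm.const_mul _)
    (Eventually.of_forall hle)).trans_eq ?_
  rw [integral_const_mul]
  change _ = (‖vecMul n‖ * C * ∫ y, ‖h y‖) * ‖x - x'‖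
  ring

theorem IsDensity.continuous_cauchyTransform {n : ℕ} (hn : 2 ≤ n) {q r : ℝ} (hq : n < q)
    {h : Eu n → Eu n} (hh : IsDensity q r h) : Continuous (cauchyTransform n 0 h) := by
  rw [continuous_iff_continuousAt]
  intro x
  have hx : ball (0 : Eu n) (‖x‖ + 1) ∈ 𝓝 x := isOpen_ball.mem_nhds (by simp)
  refine ContinuousOn.continuousAt ?_ hx
  refine (hh.tendstoUniformlyOn_cauchyTransform hn hq (‖x‖ + 1)).continuousOn ?_
  refine Eventually.frequently ?_
  filter_upwards [self_mem_nhdsWithin] with a ha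
  exact (hh.continuous_cauchyTransform_of_pos hn hq ha).continuousOn

/-- The transform of a density vanishes at infinity, as `|K(z)| = |z|^(1 - n)` with `n ≥ 2`. -/
theorem IsDensity.tendsto_cauchyTransform_zero {n : ℕ} (hn : 2 ≤ n) {q r : ℝ} (hq : n < q)
    {h : Eu n → Eu n} (hh : IsDensity q r h) :
    Tendsto (cauchyTransform n 0 h) (cocompact (Eu n)) (𝓝 0) := by
  have hn' : (2 : ℝ) ≤ n := by exact_mod_cast hn
  have hint := hh.integrable (by linarith)
  have h1 : Tendsto (fun x : Eu n => (‖x‖ - r) ^ (-((n : ℝ) - 1))) (cocompact (Eu n)) (𝓝 0) :=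
    (tendsto_rpow_neg_atTop (by linarith)).comp
      (tendsto_atTop_add_const_right _ (-r) (tendsto_norm_cocompact_atTop (E := Eu n)))
  have h2 := (h1.const_mul ‖vecMul n‖).mul_const (∫ y, ‖h y‖)
  rw [mul_zero, zero_mul] at h2
  refine squeeze_zero_norm' ?_ h2
  filter_upwards [(tendsto_norm_cocompact_atTop (E := Eu n)).eventually_gt_atTop r] with x hx
  rw [← integral_const_mul]
  refine norm_integral_le_of_norm_le (hint.norm.const_mul _) (Eventually.of_forall fun y => ?_)
  by_cases hy : r ≤ ‖y‖
  · simp [hh.eq_zero y hy]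
  · have hxy : ‖x‖ - r ≤ ‖x - y‖ := by linarith [norm_sub_norm_le x y]
    have hz : x - y ≠ 0 := norm_pos_iff.1 (by linarith)
    refine (norm_vecMul_le _ _).trans ?_
    rw [norm_cauchyKernel_zero hz]
    exact mul_le_mul_of_nonneg_right (mul_le_mul_of_nonneg_left
      (Real.rpow_le_rpow_of_nonpos (by linarith) hxy (by linarith)) (by positivity)) (norm_nonneg _)

/-! ### The Cauchy–Pompeiu formula for Lipschitz functions -/

theorem integrable_smul_of_bounded_of_hasCompactSupport {n : ℕ} {W : Type*} [NormedAddCommGroup W]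
    [NormedSpace ℝ W] {u : Eu n → ℝ} {G : Eu n → W} {C : ℝ} (hu : Measurable u)
    (hC : ∀ y, ‖u y‖ ≤ C) (hsupp : HasCompactSupport u) (hG : Continuous G) :
    Integrable fun y => u y • G y := by
  have hK : IsCompact (tsupport u) := hsupp
  have h1 : IntegrableOn u (tsupport u) :=
    Measure.integrableOn_of_bounded hK.measure_lt_top.ne hu.aestronglyMeasurable
      (Eventually.of_forall hC)
  refine (integrableOn_iff_integrable_of_support_subset ?_).1
    (h1.smul_continuousOn hG.continuousOn hK)
  intro y hy
  refine subset_tsupport u ?_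
  intro h0
  exact hy (by simp [h0])

theorem norm_gradient {n : ℕ} (φ : Eu n → ℝ) (y : Eu n) : ‖gradient φ y‖ = ‖fderiv ℝ φ y‖ :=
  LinearIsometryEquiv.norm_map _ _

theorem gradient_apply {n : ℕ} (φ : Eu n → ℝ) (y : Eu n) (j : Fin n) :
    gradient φ y j = fderiv ℝ φ y (EuclideanSpace.single j 1) := by
  have h : inner ℝ (gradient φ y) (EuclideanSpace.single j 1) =
      fderiv ℝ φ y (EuclideanSpace.single j 1) := InnerProductSpace.toDual_symm_apply
  rw [← h, EuclideanSpace.inner_single_right]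
  simp

theorem measurable_gradient {n : ℕ} (φ : Eu n → ℝ) : Measurable (gradient φ) :=
  ((InnerProductSpace.toDual ℝ (Eu n)).symm.continuous.measurable).comp (measurable_fderiv ℝ φ)

/-- Integration by parts against a compactly supported Lipschitz function. -/
theorem integral_fderiv_smul_eq {n : ℕ} {W : Type*} [NormedAddCommGroup W] [NormedSpace ℝ W]
    [FiniteDimensional ℝ W] {C D : ℝ≥0} {φ : Eu n → ℝ} {G : Eu n → W} (hφ : LipschitzWith D φ)
    (hsupp : HasCompactSupport φ) (hG : ContDiff ℝ 1 G) (hGL : LipschitzWith C G) (v : Eu n) :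
    ∫ y, fderiv ℝ φ y v • G y = -∫ y, φ y • fderiv ℝ G y v := by
  have : CompleteSpace W := FiniteDimensional.complete ℝ W
  have hsupp' : HasCompactSupport fun y => fderiv ℝ φ y v := hsupp.fderiv_apply (𝕜 := ℝ) v
  have hint1 : Integrable fun y => fderiv ℝ φ y v • G y := by
    refine integrable_smul_of_bounded_of_hasCompactSupport (C := D * ‖v‖)
      (measurable_fderiv_apply_const ℝ φ v) (fun y => ?_) hsupp' hG.continuous
    exact (ContinuousLinearMap.le_opNorm _ _).trans
      (mul_le_mul_of_nonneg_right (norm_fderiv_le_of_lipschitz ℝ hφ) (norm_nonneg v))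
  have hcont : Continuous fun y => fderiv ℝ G y v :=
    (hG.continuous_fderiv (by norm_num)).clm_apply continuous_const
  have hint2 : Integrable fun y => φ y • fderiv ℝ G y v :=
    (hφ.continuous.smul hcont).integrable_of_hasCompactSupport hsupp.smul_right
  -- continuous linear functionals reduce the claim to the scalar formula
  refine (SeparatingDual.eq_iff_forall_dual_eq (R := ℝ)).2 fun l => ?_
  rw [map_neg, ← l.integral_comp_comm hint1, ← l.integral_comp_comm hint2]
  have h1 := LipschitzWith.integral_lineDeriv_mul_eq (μ := volume)
    (l.lipschitz.comp hGL) hφ hsupp v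
  have hlG : ∀ y, lineDeriv ℝ (l ∘ G) y v = l (fderiv ℝ G y v) := by
    intro y
    have hd : HasFDerivAt (l ∘ G) (l.comp (fderiv ℝ G y)) y :=
      l.hasFDerivAt.comp y ((hG.differentiable (by norm_num)) y).hasFDerivAt
    rw [hd.differentiableAt.lineDeriv_eq_fderiv, hd.fderiv]
    rfl
  have hφd : ∀ᵐ y, lineDeriv ℝ φ y (-v) * (l ∘ G) y = -l (fderiv ℝ φ y v • G y) := by
    filter_upwards [hφ.ae_differentiableAt] with y hy
    rw [hy.lineDeriv_eq_fderiv, map_neg, map_smul, neg_mul, smul_eq_mul]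
    rfl
  rw [integral_congr_ae hφd, integral_neg] at h1
  rw [← neg_eq_iff_eq_neg, ← h1]
  refine integral_congr_ae (Eventually.of_forall fun y => ?_)
  simp only [hlG, map_smul, smul_eq_mul]
  ring

theorem isDensity_gradient {n : ℕ} {q : ℝ} (hq : 0 < q) {D : ℝ≥0} {φ : Eu n → ℝ}
    (hφ : LipschitzWith D φ) (hsupp : HasCompactSupport φ) :
    ∃ r, IsDensity q r (gradient φ) := by
  obtain ⟨r, hr⟩ := hsupp.isBounded.subset_ball 0
  refine ⟨r, IsDensity.of_bounded (C := D) hq (measurable_gradient φ) (fun y hy => ?_)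
    fun y => ?_⟩
  · have h0 : fderiv ℝ φ y = 0 := by
      by_contra h
      have := hr (support_fderiv_subset ℝ h)
      simp only [mem_ball_zero_iff] at this
      linarith
    rw [gradient, h0, map_zero]
  · rw [norm_gradient]
    exact norm_fderiv_le_of_lipschitz ℝ hφ

theorem vecMul_gradient {n : ℕ} (k : Eu n) (φ : Eu n → ℝ) (y : Eu n) :
    vecMul n k (gradient φ y) =
      ∑ j, fderiv ℝ φ y (EuclideanSpace.single j 1) • (vecCl n k * cliffordGen n j) := by
  rw [vecMul_apply, vecCl_eq_sum (gradient φ y), Finset.mul_sum]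
  simp_rw [gradient_apply, mul_smul_comm]

/-- The regularized transform of a gradient is a mollification of the function. -/
theorem cauchyTransform_gradient {n : ℕ} {a : ℝ} (ha : 0 < a) {D : ℝ≥0} {φ : Eu n → ℝ}
    (hφ : LipschitzWith D φ) (hsupp : HasCompactSupport φ) (x : Eu n) :
    cauchyTransform n a (gradient φ) x = algebraMap ℝ (Cl n)
      (-(n * ∫ y, a * (‖x - y‖ ^ 2 + a) ^ (-(n : ℝ) / 2 - 1) * φ y)) := by
  set G : Fin n → Eu n → Cl n := fun j y =>
    vecCl n (cauchyKernel n a (x - y)) * cliffordGen n j with hGdef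
  set R : Fin n → Cl n →L[ℝ] Cl n := fun j => (clMul n).flip (cliffordGen n j)
  obtain ⟨C, hC⟩ := exists_lipschitzWith_cauchyKernel (n := n) ha
  have hKd : ∀ z, HasFDerivAt (cauchyKernel n a) (fderiv ℝ (cauchyKernel n a) z) z := fun z =>
    (((contDiff_cauchyKernel ha).differentiable (by norm_num)) z).hasFDerivAt
  have hGR : ∀ j, G j = (R j ∘ vecCl n) ∘ (cauchyKernel n a ∘ fun y => x - y) := fun j => rfl
  have hG : ∀ j, ContDiff ℝ 1 (G j) := fun j => by
    rw [hGR]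
    exact ((R j).contDiff.comp (vecCl n).contDiff).comp
      ((contDiff_cauchyKernel ha).comp (contDiff_const.sub contDiff_id))
  have hGL : ∀ j, ∃ C, LipschitzWith C (G j) := fun j => by
    rw [hGR]
    exact ⟨_, ((R j).lipschitz.comp (vecCl n).lipschitz).comp
      (hC.comp ((LipschitzWith.const x).sub LipschitzWith.id))⟩
  have hG' : ∀ j y v, fderiv ℝ (G j) y v =
      -(vecCl n (fderiv ℝ (cauchyKernel n a) (x - y) v) * cliffordGen n j) := by
    intro j y v
    have h1 : HasFDerivAt (cauchyKernel n a ∘ fun y => x - y)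
        ((fderiv ℝ (cauchyKernel n a) (x - y)).comp (-ContinuousLinearMap.id ℝ (Eu n))) y :=
      (hKd (x - y)).comp y ((hasFDerivAt_id y).const_sub x)
    have h2 : HasFDerivAt (G j) (((R j).comp (vecCl n)).comp
        ((fderiv ℝ (cauchyKernel n a) (x - y)).comp (-ContinuousLinearMap.id ℝ (Eu n)))) y :=
      ((R j).comp (vecCl n)).hasFDerivAt.comp y h1
    rw [h2.fderiv]
    simp [R]
  have hint1 : ∀ j, Integrable fun y => fderiv ℝ φ y (EuclideanSpace.single j 1) • G j y := by
    intro j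
    refine integrable_smul_of_bounded_of_hasCompactSupport
      (C := D * ‖EuclideanSpace.single j (1 : ℝ)‖)
      (measurable_fderiv_apply_const ℝ φ _) (fun y => ?_) (hsupp.fderiv_apply (𝕜 := ℝ) _)
      (hG j).continuous
    exact (ContinuousLinearMap.le_opNorm _ _).trans
      (mul_le_mul_of_nonneg_right (norm_fderiv_le_of_lipschitz ℝ hφ) (norm_nonneg _))
  have hint2 : ∀ j, Integrable fun y => φ y • fderiv ℝ (G j) y (EuclideanSpace.single j 1) :=
    fun j => (hφ.continuous.smul (((hG j).continuous_fderiv (by norm_num)).clm_apply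
      continuous_const)).integrable_of_hasCompactSupport hsupp.smul_right
  rw [cauchyTransform]
  simp_rw [vecMul_gradient]
  rw [integral_finsetSum _ fun j _ => hint1 j]
  have hparts : ∀ j, ∫ y, fderiv ℝ φ y (EuclideanSpace.single j 1) • G j y =
      -∫ y, φ y • fderiv ℝ (G j) y (EuclideanSpace.single j 1) := fun j => by
    obtain ⟨C, hC⟩ := hGL j
    exact integral_fderiv_smul_eq hφ hsupp (hG j) hC _
  rw [Finset.sum_congr rfl fun j _ => hparts j, Finset.sum_neg_distrib,
    ← integral_finsetSum _ fun j _ => hint2 j]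
  have hsum : ∀ y, ∑ j, φ y • fderiv ℝ (G j) y (EuclideanSpace.single j 1) =
      ((n : ℝ) * (a * (‖x - y‖ ^ 2 + a) ^ (-(n : ℝ) / 2 - 1) * φ y)) • (1 : Cl n) := by
    intro y
    rw [← Finset.smul_sum]
    simp_rw [hG']
    rw [Finset.sum_neg_distrib, sum_fderiv_cauchyKernel_mul_cliffordGen ha,
      Algebra.algebraMap_eq_smul_one, ← neg_smul, smul_smul]
    congr 1
    ring
  simp_rw [hsum]
  rw [integral_smul_const, integral_const_mul, Algebra.algebraMap_eq_smul_one, neg_smul]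

/-- The mass of the approximate identity that the Dirac operator produces from the regularized
Cauchy kernels. -/
noncomputable def cauchyMass (n : ℕ) : ℝ :=
  n * ∫ z : Eu n, (1 + ‖z‖ ^ 2) ^ (-((n : ℝ) + 2) / 2)

theorem integrable_cauchyMass (n : ℕ) :
    Integrable fun z : Eu n => (1 + ‖z‖ ^ 2) ^ (-((n : ℝ) + 2) / 2) :=
  integrable_rpow_neg_one_add_norm_sq (by rw [finrank_euclideanSpace_fin]; linarith)

theorem cauchyMass_pos {n : ℕ} (hn : 2 ≤ n) : 0 < cauchyMass n := by
  refine mul_pos (by positivity) ?_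
  have hc : Continuous fun z : Eu n => (1 + ‖z‖ ^ 2) ^ (-((n : ℝ) + 2) / 2) :=
    Continuous.rpow_const (by fun_prop) fun z => Or.inl (by positivity)
  exact integral_pos_of_integrable_nonneg_nonzero (x := 0) hc (integrable_cauchyMass n)
    (fun z => by positivity) (by simp)

/-- The kernel of `cauchyTransform_gradient` for `a = ε ^ 2` is the dilation to scale `ε` of the
fixed profile `(1 + |z|²) ^ (-(n + 2) / 2)`. -/
theorem integral_mollifier_eq {n : ℕ} {ε : ℝ} (hε : 0 < ε) (φ : Eu n → ℝ) (x : Eu n) :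
    ∫ y, ε ^ 2 * (‖x - y‖ ^ 2 + ε ^ 2) ^ (-(n : ℝ) / 2 - 1) * φ y =
      ∫ z, (1 + ‖z‖ ^ 2) ^ (-((n : ℝ) + 2) / 2) * φ (x - ε • z) := by
  have h1 := integral_sub_left_eq_self (μ := (volume : Measure (Eu n)))
    (fun w => ε ^ 2 * (‖w‖ ^ 2 + ε ^ 2) ^ (-(n : ℝ) / 2 - 1) * φ (x - w)) x
  simp only [sub_sub_cancel] at h1
  have h2 := Measure.integral_comp_smul (volume : Measure (Eu n))
    (fun w => ε ^ 2 * (‖w‖ ^ 2 + ε ^ 2) ^ (-(n : ℝ) / 2 - 1) * φ (x - w)) ε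
  rw [finrank_euclideanSpace_fin, abs_of_pos (by positivity), smul_eq_mul] at h2
  rw [h1]
  have h3 : ∀ z : Eu n, ε ^ 2 * (‖ε • z‖ ^ 2 + ε ^ 2) ^ (-(n : ℝ) / 2 - 1) * φ (x - ε • z) =
      (ε ^ n)⁻¹ * ((1 + ‖z‖ ^ 2) ^ (-((n : ℝ) + 2) / 2) * φ (x - ε • z)) := by
    intro z
    have h4 : ‖ε • z‖ ^ 2 + ε ^ 2 = ε ^ 2 * (1 + ‖z‖ ^ 2) := by
      rw [norm_smul, Real.norm_of_nonneg hε.le]; ring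
    have h5 : (ε ^ 2) ^ (-((n : ℝ) + 2) / 2) = (ε ^ n)⁻¹ * (ε ^ 2)⁻¹ := by
      rw [← mul_inv, ← pow_add, ← Real.rpow_natCast ε 2, ← Real.rpow_mul hε.le,
        ← Real.rpow_natCast ε (n + 2), ← Real.rpow_neg hε.le]
      congr 1
      push_cast
      ring
    rw [h4, show -(n : ℝ) / 2 - 1 = -((n : ℝ) + 2) / 2 by ring,
      Real.mul_rpow (by positivity) (by positivity), h5]
    field_simp
  simp_rw [h3] at h2
  rw [integral_const_mul] at h2
  exact (mul_left_cancel₀ (by positivity) h2).symm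

theorem tendsto_integral_mollifier {n : ℕ} {φ : Eu n → ℝ} (hφ : Continuous φ)
    (hsupp : HasCompactSupport φ) (x : Eu n) :
    Tendsto (fun ε : ℝ => ∫ z, (1 + ‖z‖ ^ 2) ^ (-((n : ℝ) + 2) / 2) * φ (x - ε • z)) (𝓝[>] 0)
      (𝓝 ((∫ z : Eu n, (1 + ‖z‖ ^ 2) ^ (-((n : ℝ) + 2) / 2)) * φ x)) := by
  obtain ⟨C, hC⟩ := hsupp.exists_bound_of_continuous hφ
  rw [← integral_mul_const]
  refine tendsto_integral_filter_of_dominated_convergence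
    (fun z => (1 + ‖z‖ ^ 2) ^ (-((n : ℝ) + 2) / 2) * C) ?_ ?_
    ((integrable_cauchyMass n).mul_const C) ?_
  · refine Eventually.of_forall fun ε => Measurable.aestronglyMeasurable ?_
    have := hφ.measurable
    fun_prop
  · refine Eventually.of_forall fun ε => Eventually.of_forall fun z => ?_
    rw [norm_mul, Real.norm_of_nonneg (by positivity)]
    exact mul_le_mul_of_nonneg_left (hC _) (by positivity)
  · refine Eventually.of_forall fun z => Tendsto.const_mul _ ?_
    have h1 : Continuous fun ε : ℝ => φ (x - ε • z) := by fun_prop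
    have h2 := h1.tendsto 0
    rw [zero_smul, sub_zero] at h2
    exact h2.mono_left nhdsWithin_le_nhds

/-- The Cauchy–Pompeiu formula: the Cauchy transform of the gradient of a compactly supported
Lipschitz function recovers the function. -/
theorem cauchyTransform_zero_gradient {n : ℕ} (hn : 2 ≤ n) {D : ℝ≥0} {φ : Eu n → ℝ}
    (hφ : LipschitzWith D φ) (hsupp : HasCompactSupport φ) (x : Eu n) :
    cauchyTransform n 0 (gradient φ) x = algebraMap ℝ (Cl n) (-(cauchyMass n * φ x)) := by
  obtain ⟨r, hd⟩ := isDensity_gradient (q := (n : ℝ) + 1) (by positivity) hφ hsupp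
  -- the regularization parameter `a` is the square of the length scale `ε`
  have hsq : Tendsto (fun ε : ℝ => ε ^ 2) (𝓝[>] 0) (𝓝[>] 0) := by
    refine tendsto_nhdsWithin_iff.2 ⟨?_, ?_⟩
    · have : Tendsto (fun ε : ℝ => ε ^ 2) (𝓝 0) (𝓝 (0 ^ 2)) := (continuous_pow 2).tendsto 0
      rw [zero_pow two_ne_zero] at this
      exact this.mono_left nhdsWithin_le_nhds
    · filter_upwards [self_mem_nhdsWithin] with ε hε
      exact pow_pos (Set.mem_Ioi.1 hε) 2
  have h1 : Tendsto (fun ε : ℝ => cauchyTransform n (ε ^ 2) (gradient φ) x) (𝓝[>] 0)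
      (𝓝 (cauchyTransform n 0 (gradient φ) x)) :=
    ((hd.tendstoUniformlyOn_cauchyTransform hn (by linarith) (‖x‖ + 1)).tendsto_at
      (x := x) (by simp)).comp hsq
  have h2 : Tendsto (fun ε : ℝ => cauchyTransform n (ε ^ 2) (gradient φ) x) (𝓝[>] 0)
      (𝓝 (algebraMap ℝ (Cl n) (-(cauchyMass n * φ x)))) := by
    have h3 := ((tendsto_integral_mollifier hφ.continuous hsupp x).const_mul (n : ℝ)).neg.smul_const
      (1 : Cl n)
    rw [← mul_assoc, ← cauchyMass, ← Algebra.algebraMap_eq_smul_one] at h3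
    refine h3.congr' ?_
    filter_upwards [self_mem_nhdsWithin] with ε hε
    have hε' : 0 < ε := hε
    rw [cauchyTransform_gradient (pow_pos hε' 2) hφ hsupp, integral_mollifier_eq hε',
      Algebra.algebraMap_eq_smul_one]
  exact tendsto_nhds_unique h1 h2

/-! ### Monogenicity of the Cauchy transform off the support of the density -/

/-- The Cauchy kernel can be cut off, near the origin and near infinity, to a compactly supported
function of class `C¹`. -/
theorem exists_contDiff_cauchyKernel_cutoff {n : ℕ} {δ R : ℝ} (hδ : 0 < δ) (hR : δ < R) :
    ∃ K : Eu n → Eu n, ContDiff ℝ 1 K ∧ HasCompactSupport K ∧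
      ∀ z, δ ≤ ‖z‖ → ‖z‖ ≤ R → K z = cauchyKernel n 0 z := by
  let b₁ : ContDiffBump (0 : Eu n) := ⟨δ / 2, δ, by positivity, by linarith⟩
  let b₂ : ContDiffBump (0 : Eu n) := ⟨R, R + 1, by linarith, by linarith⟩
  refine ⟨fun z => (b₂ z - b₁ z) • cauchyKernel n 0 z, contDiff_iff_contDiffAt.2 fun z => ?_,
    HasCompactSupport.intro (isCompact_closedBall 0 (R + 1)) fun z hz => ?_, fun z h1 h2 => ?_⟩
  · rcases eq_or_ne z 0 with rfl | hz
    · refine (contDiffAt_const (c := (0 : Eu n))).congr_of_eventuallyEq ?_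
      filter_upwards [ball_mem_nhds (0 : Eu n) (half_pos hδ)] with z hz
      rw [b₁.one_of_mem_closedBall (ball_subset_closedBall hz),
        b₂.one_of_mem_closedBall (closedBall_subset_closedBall (by change δ / 2 ≤ R; linarith)
          (ball_subset_closedBall hz)), sub_self, zero_smul]
    · exact (b₂.contDiff.contDiffAt.sub b₁.contDiff.contDiffAt).smul
        (contDiffAt_cauchyKernel (by positivity))
  · simp only [mem_closedBall_zero_iff, not_le] at hz
    rw [b₁.zero_of_le_dist (by rw [dist_zero_right]; change δ ≤ _; linarith),
      b₂.zero_of_le_dist (by rw [dist_zero_right]; exact hz.le), sub_self, zero_smul]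
  · simp only
    rw [b₁.zero_of_le_dist (by rw [dist_zero_right]; exact h1),
      b₂.one_of_mem_closedBall (by simpa using h2), sub_zero, one_smul]

/-- Near a point outside the support of the density only values of the kernel away from the origin
matter, so the transform is of class `C¹` there and inherits monogenicity from the kernel. -/
theorem contDiffAt_cauchyTransform_and_diracOp_eq_zero {n : ℕ} {r ρ : ℝ} {k : Eu n → Eu n}
    (hk : Integrable k) (hr : ∀ y, r ≤ ‖y‖ → k y = 0) {x₀ : Eu n} (hρ : 0 < ρ)
    (h0 : ∀ y ∈ ball x₀ ρ, k y = 0) :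
    ContDiffAt ℝ 1 (cauchyTransform n 0 k) x₀ ∧ diracOp (cauchyTransform n 0 k) x₀ = 0 := by
  obtain ⟨K, hK, hKs, hKeq⟩ := exists_contDiff_cauchyKernel_cutoff (n := n) (δ := ρ / 2)
    (R := ‖x₀‖ + ρ + |r|) (by positivity) (by linarith [norm_nonneg x₀, abs_nonneg r])
  have hy : ∀ y, k y ≠ 0 → ρ ≤ ‖x₀ - y‖ ∧ ‖x₀ - y‖ < ‖x₀‖ + |r| := by
    intro y hy
    constructor
    · by_contra h
      exact hy (h0 y (by rwa [mem_ball, dist_comm, dist_eq_norm, ← not_le]))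
    · have h1 : ‖y‖ < r := by
        by_contra h
        exact hy (hr y (not_lt.1 h))
      linarith [norm_sub_le x₀ y, le_abs_self r]
  -- near `x₀` the transform is a convolution with the cut-off kernel, which can be differentiated
  have heq : convolution K k (vecMul n) volume =ᶠ[𝓝 x₀] cauchyTransform n 0 k := by
    filter_upwards [ball_mem_nhds x₀ (half_pos hρ)] with x hx
    rw [convolution_eq_swap, cauchyTransform]
    refine integral_congr_ae (Eventually.of_forall fun y => ?_)
    by_cases hky : k y = 0
    · simp [hky]
    · obtain ⟨h1, h2⟩ := hy y hky
      rw [mem_ball, dist_eq_norm] at hx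
      have h3 : ‖x - y‖ ≤ ‖x - x₀‖ + ‖x₀ - y‖ := norm_sub_le_norm_sub_add_norm_sub _ _ _
      have h4 : ‖x₀ - y‖ ≤ ‖x - x₀‖ + ‖x - y‖ := by
        rw [norm_sub_rev x x₀]; exact norm_sub_le_norm_sub_add_norm_sub _ _ _
      simp only
      rw [hKeq _ (by linarith) (by linarith)]
  have hloc := hk.locallyIntegrable
  have hsmooth := hKs.contDiff_convolution_left (n := 1) (vecMul n) hK hloc
  refine ⟨hsmooth.contDiffAt.congr_of_eventuallyEq heq.symm, ?_⟩
  have hd := (hKs.hasFDerivAt_convolution_left (vecMul n) hK hloc x₀).congr_of_eventuallyEq heq.symm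
  have hint : Integrable fun y => ((vecMul n).precompL (Eu n)) (fderiv ℝ K (x₀ - y)) (k y) :=
    ((hKs.fderiv (𝕜 := ℝ)).convolutionExists_left ((vecMul n).precompL (Eu n))
      (hK.continuous_fderiv (by norm_num)) hloc x₀).integrable_swap
  have happly : ∀ v : Eu n, fderiv ℝ (cauchyTransform n 0 k) x₀ v =
      ∫ y, vecMul n (fderiv ℝ K (x₀ - y) v) (k y) := by
    intro v
    rw [hd.fderiv, convolution_eq_swap, ContinuousLinearMap.integral_apply hint]
    rfl
  have hintv : ∀ v : Eu n, Integrable fun y => vecMul n (fderiv ℝ K (x₀ - y) v) (k y) :=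
    fun v => hint.apply_continuousLinearMap v
  rw [diracOp]
  have hmul : ∀ j, cliffordGen n j *
      fderiv ℝ (cauchyTransform n 0 k) x₀ (EuclideanSpace.single j 1) =
        ∫ y, clMul n (cliffordGen n j)
          (vecMul n (fderiv ℝ K (x₀ - y) (EuclideanSpace.single j 1)) (k y)) := by
    intro j
    rw [(clMul n (cliffordGen n j)).integral_comp_comm (hintv _), ← happly, clMul_apply]
  simp_rw [hmul]
  rw [← integral_finsetSum _ fun j _ =>
    (clMul n (cliffordGen n j)).integrable_comp (hintv _)]
  refine (integral_congr_ae (Eventually.of_forall fun y => ?_)).trans (integral_zero _ _)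
  by_cases hky : k y = 0
  · simp [hky]
  · obtain ⟨h1, h2⟩ := hy y hky
    have hz : x₀ - y ≠ 0 := norm_pos_iff.1 (by linarith)
    have h3 : ρ / 2 < ‖x₀ - y‖ := by linarith
    have h4 : ‖x₀ - y‖ < ‖x₀‖ + ρ + |r| := by linarith
    have hKz : fderiv ℝ K (x₀ - y) = fderiv ℝ (cauchyKernel n 0) (x₀ - y) := by
      refine Filter.EventuallyEq.fderiv_eq ?_
      filter_upwards [continuous_norm.continuousAt.eventually (lt_mem_nhds h3),
        continuous_norm.continuousAt.eventually (gt_mem_nhds h4)] with z h5 h6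
      exact hKeq z h5.le h6.le
    simp only [clMul_apply, vecMul_apply, hKz, ← mul_assoc]
    rw [← Finset.sum_mul, sum_cliffordGen_mul_fderiv_cauchyKernel hz, zero_mul]

/-! ### Extension of Hölder functions with gradient control -/

theorem abs_rpow_sub_rpow_le {ν δ a b : ℝ} (hν1 : ν ≤ 1) (hδ : 0 < δ) (ha : δ ≤ a) (hb : δ ≤ b)
    (hν0 : 0 ≤ ν) : |a ^ ν - b ^ ν| ≤ δ ^ (ν - 1) * |a - b| := by
  wlog hab : b ≤ a generalizing a b
  · rw [abs_sub_comm, abs_sub_comm a b]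
    exact this hb ha (le_of_not_ge hab)
  have hb0 : 0 < b := hδ.trans_le hb
  have ha0 : 0 < a := hδ.trans_le ha
  rw [abs_of_nonneg (sub_nonneg.2 (Real.rpow_le_rpow hb0.le hab hν0)),
    abs_of_nonneg (sub_nonneg.2 hab)]
  have h1 : ∀ t : ℝ, 0 < t → t ^ ν = t ^ (ν - 1) * t := fun t ht => by
    rw [Real.rpow_sub_one ht.ne', div_mul_cancel₀ _ ht.ne']
  rw [h1 a ha0, h1 b hb0]
  have h2 : a ^ (ν - 1) ≤ b ^ (ν - 1) := Real.rpow_le_rpow_of_nonpos hb0 hab (by linarith)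
  have h3 : b ^ (ν - 1) ≤ δ ^ (ν - 1) := Real.rpow_le_rpow_of_nonpos hδ hb (by linarith)
  nlinarith [mul_le_mul_of_nonneg_right h2 ha0.le,
    mul_le_mul_of_nonneg_right h3 (sub_nonneg.2 hab)]

theorem abs_rpow_sub_rpow_le_rpow_abs_sub {ν a b : ℝ} (hν0 : 0 ≤ ν) (hν1 : ν ≤ 1) (ha : 0 ≤ a)
    (hb : 0 ≤ b) : |a ^ ν - b ^ ν| ≤ |a - b| ^ ν := by
  wlog hab : b ≤ a generalizing a b
  · rw [abs_sub_comm, abs_sub_comm a b]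
    exact this hb ha (le_of_not_ge hab)
  rw [abs_of_nonneg (sub_nonneg.2 (Real.rpow_le_rpow hb hab hν0)),
    abs_of_nonneg (sub_nonneg.2 hab)]
  have := Real.rpow_add_le_add_rpow (sub_nonneg.2 hab) hb hν0 hν1
  rw [sub_add_cancel] at this
  linarith

/-- The extension `x ↦ inf_{s ∈ S} (g s + M |x - s|^ν)` of a function on `S`. -/
noncomputable def holderExtension {n : ℕ} (S : Set (Eu n)) (g : Eu n → ℝ) (M ν : ℝ) (x : Eu n) :
    ℝ :=
  ⨅ s : S, (g s + M * dist x s ^ ν)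

theorem bddBelow_holderExtension {n : ℕ} {S : Set (Eu n)} {g : Eu n → ℝ} (hg : BddBelow (g '' S))
    {M : ℝ} (hM : 0 ≤ M) (ν : ℝ) (x : Eu n) :
    BddBelow (Set.range fun s : S => g s + M * dist x s ^ ν) := by
  obtain ⟨m, hm⟩ := hg
  refine ⟨m, ?_⟩
  rintro _ ⟨s, rfl⟩
  have h1 : m ≤ g s := hm ⟨s, s.2, rfl⟩
  have h2 : 0 ≤ M * dist x s ^ ν := by positivity
  simp only
  linarith

/-- The infimum inherits every bound on increments that its competitors satisfy uniformly. -/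
theorem abs_holderExtension_sub_le {n : ℕ} {S : Set (Eu n)} (hS : S.Nonempty) {g : Eu n → ℝ}
    (hg : BddBelow (g '' S)) {M : ℝ} (hM : 0 ≤ M) {ν L : ℝ} {x y : Eu n}
    (h : ∀ s ∈ S, |dist x s ^ ν - dist y s ^ ν| ≤ L) :
    |holderExtension S g M ν x - holderExtension S g M ν y| ≤ M * L := by
  have : Nonempty S := hS.to_subtype
  have key : ∀ x y : Eu n, (∀ s ∈ S, |dist x s ^ ν - dist y s ^ ν| ≤ L) →
      holderExtension S g M ν x - M * L ≤ holderExtension S g M ν y := by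
    intro x y h
    refine le_ciInf fun s => ?_
    have h1 : holderExtension S g M ν x ≤ g s + M * dist x s ^ ν :=
      ciInf_le (bddBelow_holderExtension hg hM ν x) s
    have h2 := mul_le_mul_of_nonneg_left ((le_abs_self _).trans (h s s.2)) hM
    linarith
  rw [abs_sub_le_iff]
  have h1 := key x y h
  have h2 := key y x fun s hs => by rw [abs_sub_comm]; exact h s hs
  constructor <;> linarith

theorem holderExtension_eq {n : ℕ} {S : Set (Eu n)} {g : Eu n → ℝ}
    (hgb : BddBelow (g '' S)) {M ν : ℝ≥0} (hν : 0 < ν) (hg : HolderOnWith M ν g S) {x : Eu n}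
    (hx : x ∈ S) : holderExtension S g M ν x = g x := by
  have : Nonempty S := ⟨⟨x, hx⟩⟩
  apply le_antisymm
  · refine (ciInf_le (bddBelow_holderExtension hgb M.2 ν x) ⟨x, hx⟩).trans ?_
    simp [Real.zero_rpow (NNReal.coe_pos.2 hν).ne']
  · refine le_ciInf fun s => ?_
    have h1 := hg.dist_le hx s.2
    rw [Real.dist_eq] at h1
    linarith [le_abs_self (g x - g s)]

theorem continuous_holderExtension {n : ℕ} {S : Set (Eu n)} (hS : S.Nonempty) {g : Eu n → ℝ}
    (hgb : BddBelow (g '' S)) (M : ℝ≥0) {ν : ℝ≥0} (hν0 : 0 < ν) (hν1 : ν ≤ 1) :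
    Continuous (holderExtension S g M ν) := by
  have : HolderWith M ν (holderExtension S g M ν) := by
    intro x y
    rw [edist_dist, edist_dist, ENNReal.ofReal_rpow_of_nonneg dist_nonneg ν.coe_nonneg,
      ← ENNReal.ofReal_coe_nnreal, ← ENNReal.ofReal_mul M.coe_nonneg]
    refine ENNReal.ofReal_le_ofReal (abs_holderExtension_sub_le hS hgb M.2 fun s _ => ?_)
    refine (abs_rpow_sub_rpow_le_rpow_abs_sub ν.2 (by exact_mod_cast hν1) dist_nonneg
      dist_nonneg).trans ?_
    exact Real.rpow_le_rpow (abs_nonneg _) (abs_dist_sub_le x y s) ν.2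
  exact this.continuous hν0

/-- The function `u` truncated to the values between the two cones `± N (ρ - |x - x₀|)⁺`. This cuts
`u` off outside a ball without spoiling Lipschitz bounds. -/
noncomputable def coneTruncation {n : ℕ} (x₀ : Eu n) (N ρ : ℝ) (u : Eu n → ℝ) (x : Eu n) : ℝ :=
  max (-(N * max 0 (ρ - dist x x₀))) (min (N * max 0 (ρ - dist x x₀)) (u x))

theorem coneTruncation_eq_zero {n : ℕ} {x₀ x : Eu n} {N ρ : ℝ} (u : Eu n → ℝ)
    (h : ρ ≤ dist x x₀) : coneTruncation x₀ N ρ u x = 0 := by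
  have h0 : max 0 (ρ - dist x x₀) = 0 := max_eq_left (by linarith)
  rw [coneTruncation, h0, mul_zero, neg_zero]
  exact max_eq_left (min_le_left _ _)

theorem coneTruncation_eq {n : ℕ} {x₀ x : Eu n} {N ρ : ℝ} (hN : 0 ≤ N) {u : Eu n → ℝ}
    (h : |u x| ≤ N * (ρ - dist x x₀)) : coneTruncation x₀ N ρ u x = u x := by
  have h1 : N * (ρ - dist x x₀) ≤ N * max 0 (ρ - dist x x₀) :=
    mul_le_mul_of_nonneg_left (le_max_right _ _) hN
  obtain ⟨h2, h3⟩ := abs_le.1 (h.trans h1)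
  rw [coneTruncation, min_eq_right h3, max_eq_right h2]

theorem abs_coneTruncation_sub_le {n : ℕ} (x₀ : Eu n) {N : ℝ} (ρ : ℝ) (hN : 0 ≤ N) (u : Eu n → ℝ)
    (x y : Eu n) : |coneTruncation x₀ N ρ u x - coneTruncation x₀ N ρ u y| ≤
      max (N * dist x y) |u x - u y| := by
  set w : Eu n → ℝ := fun x => N * max 0 (ρ - dist x x₀) with hw
  have h1 : |w x - w y| ≤ N * dist x y := by
    rw [hw]
    simp only
    rw [← mul_sub, abs_mul, abs_of_nonneg hN]
    refine mul_le_mul_of_nonneg_left ((abs_max_sub_max_le_max _ _ _ _).trans ?_) hN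
    rw [sub_self, abs_zero, sub_sub_sub_cancel_left, abs_sub_comm]
    exact max_le dist_nonneg (abs_dist_sub_le x y x₀)
  refine (abs_max_sub_max_le_max _ _ _ _).trans (max_le ?_ ?_)
  · rw [neg_sub_neg, abs_sub_comm]
    exact h1.trans (le_max_left _ _)
  · exact (abs_min_sub_min_le_max _ _ _ _).trans (max_le_max h1 le_rfl)

theorem continuous_coneTruncation {n : ℕ} (x₀ : Eu n) (N ρ : ℝ) {u : Eu n → ℝ}
    (hu : Continuous u) : Continuous (coneTruncation x₀ N ρ u) := by
  unfold coneTruncation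
  fun_prop

/-- A function that is Lipschitz near a point agrees there with a compactly supported function that
is Lipschitz on the whole space. -/
theorem exists_lipschitzWith_eventuallyEq {n : ℕ} {x₀ : Eu n} {δ : ℝ} (hδ : 0 < δ) {L : ℝ≥0}
    {u : Eu n → ℝ} (hu : LipschitzOnWith L u (ball x₀ δ)) :
    ∃ (φ : Eu n → ℝ) (D : ℝ≥0), LipschitzWith D φ ∧ HasCompactSupport φ ∧ φ =ᶠ[𝓝 x₀] u := by
  obtain ⟨v, hv, hvu⟩ := hu.extend_real
  -- `A` bounds `|v|` on the ball; the slope `N` makes the cone at least `A` high on the half ball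
  set A : ℝ := |v x₀| + L * δ with hA
  have hA0 : 0 ≤ A := by positivity
  set N : ℝ≥0 := ⟨A / (δ / 2), by positivity⟩ with hN
  refine ⟨coneTruncation x₀ N δ v, max N L, LipschitzWith.of_dist_le_mul fun x y => ?_,
    HasCompactSupport.intro (isCompact_closedBall x₀ δ) fun x hx => ?_, ?_⟩
  · rw [Real.dist_eq]
    refine (abs_coneTruncation_sub_le x₀ δ N.2 v x y).trans (max_le ?_ ?_)
    · exact mul_le_mul_of_nonneg_right (NNReal.coe_le_coe.2 (le_max_left _ _)) dist_nonneg
    · exact (hv.dist_le_mul x y).trans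
        (mul_le_mul_of_nonneg_right (NNReal.coe_le_coe.2 (le_max_right _ _)) dist_nonneg)
  · rw [mem_closedBall, not_le] at hx
    exact coneTruncation_eq_zero v hx.le
  · filter_upwards [ball_mem_nhds x₀ (half_pos hδ)] with x hx
    rw [mem_ball] at hx
    rw [hvu (show x ∈ ball x₀ δ by rw [mem_ball]; linarith)]
    refine coneTruncation_eq N.2 ?_
    have h1 : |v x| ≤ A := by
      have h2 := hv.dist_le_mul x x₀
      rw [Real.dist_eq] at h2
      have h3 : (L : ℝ) * dist x x₀ ≤ L * δ := mul_le_mul_of_nonneg_left (by linarith) L.2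
      have h4 := abs_sub_abs_le_abs_sub (v x) (v x₀)
      linarith
    have h2 : (N : ℝ) * (δ / 2) = A := div_mul_cancel₀ A (half_pos hδ).ne'
    have h3 : (N : ℝ) * (δ / 2) ≤ N * (δ - dist x x₀) :=
      mul_le_mul_of_nonneg_left (by linarith) N.2
    exact h1.trans (h2.symm.le.trans h3)

/-- A Hölder function on a compact set extends to a compactly supported continuous function that
is Lipschitz at distance `δ` from the set, with a constant of the order of `δ ^ (ν - 1)`. -/
theorem exists_extension {n : ℕ} {S : Set (Eu n)} (hS : IsCompact S) (hne : S.Nonempty) {r : ℝ}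
    (hr : S ⊆ ball 0 r) {M ν : ℝ≥0} (hν0 : 0 < ν) (hν1 : ν ≤ 1) {g : Eu n → ℝ}
    (hg : HolderOnWith M ν g S) :
    ∃ (f : Eu n → ℝ) (N r' : ℝ), 0 ≤ N ∧ r' < r ∧ Continuous f ∧ Set.EqOn f g S ∧
      (∀ x, r' ≤ ‖x‖ → f x = 0) ∧
      ∀ δ > 0, ∀ x y, δ ≤ infDist x S → δ ≤ infDist y S →
        |f x - f y| ≤ max N (M * δ ^ ((ν : ℝ) - 1)) * dist x y := by
  have himg : IsCompact (g '' S) := hS.image_of_continuousOn (hg.continuousOn hν0)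
  have hgb : BddBelow (g '' S) := himg.bddBelow
  obtain ⟨A, hA⟩ := himg.isBounded.exists_norm_le
  -- a cone of radius `r₁` whose height over the ball of radius `r₂ < r₁` is at least `A`, so that
  -- truncation does not change the values on `S`
  obtain ⟨r₁, hr₁, hS₁⟩ := exists_lt_subset_ball hS.isClosed hr
  obtain ⟨r₂, hr₂, hS₂⟩ := exists_lt_subset_ball hS.isClosed hS₁
  have hA0 : 0 ≤ A := by
    obtain ⟨s, hs⟩ := hne
    exact (norm_nonneg _).trans (hA _ ⟨s, hs, rfl⟩)
  have hr12 : 0 < r₁ - r₂ := by linarith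
  have hN : 0 ≤ A / (r₁ - r₂) := by positivity
  refine ⟨coneTruncation 0 (A / (r₁ - r₂)) r₁ (holderExtension S g M ν), A / (r₁ - r₂), r₁,
    hN, hr₁, continuous_coneTruncation _ _ _ (continuous_holderExtension hne hgb M hν0 hν1),
    fun x hx => ?_, fun x hx => coneTruncation_eq_zero _ (by rwa [dist_zero_right]),
    fun δ hδ x y hx hy => ?_⟩
  · have hxg := holderExtension_eq hgb hν0 hg hx
    rw [coneTruncation_eq hN, hxg]
    rw [hxg]
    refine (hA _ ⟨x, hx, rfl⟩).trans ?_
    have h1 : dist x 0 < r₂ := hS₂ hx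
    calc A = A / (r₁ - r₂) * (r₁ - r₂) := (div_mul_cancel₀ A hr12.ne').symm
      _ ≤ _ := mul_le_mul_of_nonneg_left (by linarith) hN
  · refine (abs_coneTruncation_sub_le _ _ hN _ _ _).trans (max_le ?_ ?_)
    · exact mul_le_mul_of_nonneg_right (le_max_left _ _) dist_nonneg
    · refine le_trans ?_ (mul_le_mul_of_nonneg_right (le_max_right _ _) dist_nonneg)
      rw [mul_assoc]
      refine abs_holderExtension_sub_le hne hgb M.2 fun s hs => ?_
      refine (abs_rpow_sub_rpow_le (by exact_mod_cast hν1) hδ (hx.trans (infDist_le_dist_of_mem hs))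
        (hy.trans (infDist_le_dist_of_mem hs)) ν.2).trans ?_
      exact mul_le_mul_of_nonneg_left (abs_dist_sub_le x y s) (by positivity)

/-! ### The jump problem for real-valued data -/

/-- A gradient bounded by `dist ^ (ν - 1)` gives a density when `∫ dist ^ (-p)` converges for some
`p ≥ q (1 - ν)`. -/
theorem isDensity_indicator_gradient {n : ℕ} {S U : Set (Eu n)} {r ν p q C : ℝ} (hne : S.Nonempty)
    (hS : IsClosed S) (hr : S ⊆ ball 0 r) (hU : IsOpen U) (hUS : Disjoint U S) (hq : 0 < q)
    (hpq : q * (1 - ν) ≤ p) (hI : marcinkiewiczIntegral S (U ∩ ball 0 r) p < ∞) {f : Eu n → ℝ}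
    (hf0 : ∀ x, r ≤ ‖x‖ → gradient f x = 0) (hC0 : 0 ≤ C)
    (hf : ∀ x, x ∉ S → ‖x‖ < r → ‖gradient f x‖ ≤ C * infDist x S ^ (ν - 1)) :
    IsDensity q r (U.indicator (gradient f)) where
  measurable := (measurable_gradient f).indicator hU.measurableSet
  eq_zero x hx := by
    rw [Set.indicator_apply_eq_zero]
    exact fun _ => hf0 x hx
  lintegral_lt_top := by
    obtain ⟨s₀, hs₀⟩ := hne
    -- distances to `S` are at most `2 r` inside the ball, which absorbs the surplus of `p`
    set c : ℝ := C ^ q * (2 * r) ^ (p - q * (1 - ν)) with hc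
    have hle : ∀ x, ‖U.indicator (gradient f) x‖ₑ ^ q ≤ (U ∩ ball (0 : Eu n) r).indicator
        (fun x => ENNReal.ofReal c * ENNReal.ofReal (1 / infDist x S ^ p)) x := by
      intro x
      by_cases hx : x ∈ U ∩ ball (0 : Eu n) r
      · rw [Set.indicator_of_mem hx, Set.indicator_of_mem hx.1]
        have hxS : x ∉ S := Set.disjoint_left.1 hUS hx.1
        have hxr : ‖x‖ < r := by simpa using hx.2
        have hd : 0 < infDist x S := (hS.notMem_iff_infDist_pos ⟨s₀, hs₀⟩).1 hxS
        have hd2 : infDist x S ≤ 2 * r := by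
          have h1 := infDist_le_dist_of_mem (x := x) hs₀
          have h2 : ‖s₀‖ < r := by simpa using hr hs₀
          rw [dist_eq_norm] at h1
          linarith [norm_sub_le x s₀]
        rw [← ofReal_norm, ENNReal.ofReal_rpow_of_nonneg (norm_nonneg _) hq.le,
          ← ENNReal.ofReal_mul (by
            have : 0 < 2 * r := hd.trans_le hd2
            positivity)]
        refine ENNReal.ofReal_le_ofReal ?_
        calc ‖gradient f x‖ ^ q ≤ (C * infDist x S ^ (ν - 1)) ^ q :=
              Real.rpow_le_rpow (norm_nonneg _) (hf x hxS hxr) hq.le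
          _ = C ^ q * (infDist x S ^ (p - q * (1 - ν)) * (1 / infDist x S ^ p)) := by
              rw [Real.mul_rpow hC0 (by positivity), ← Real.rpow_mul hd.le, one_div,
                ← Real.rpow_neg hd.le, ← Real.rpow_add hd]
              congr 2
              ring
          _ ≤ C ^ q * ((2 * r) ^ (p - q * (1 - ν)) * (1 / infDist x S ^ p)) := by
              gcongr
          _ = c * (1 / infDist x S ^ p) := by rw [hc]; ring
      · rw [Set.indicator_of_notMem hx]
        have h0 : U.indicator (gradient f) x = 0 := by
          rw [Set.indicator_apply_eq_zero]
          intro hxU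
          exact hf0 x (not_lt.1 fun h => hx ⟨hxU, by simpa using h⟩)
        rw [h0]
        simp [hq]
    refine (lintegral_mono hle).trans_lt ?_
    rw [lintegral_indicator (hU.inter isOpen_ball).measurableSet,
      lintegral_const_mul' _ _ ENNReal.ofReal_ne_top]
    exact ENNReal.mul_lt_top ENNReal.ofReal_lt_top hI

/-- The gradient bound for the extensions of `exists_extension`, from the Lipschitz bound on the
ball about `x` of radius half the distance to `S`. -/
theorem norm_gradient_le_of_extension {n : ℕ} {S : Set (Eu n)} {f : Eu n → ℝ} {N M ν r : ℝ}
    (hne : S.Nonempty) (hS : IsClosed S) (hr : S ⊆ ball 0 r) (hN : 0 ≤ N) (hM : 0 ≤ M) (hν1 : ν ≤ 1)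
    (hf : ∀ δ > 0, ∀ x y, δ ≤ infDist x S → δ ≤ infDist y S →
        |f x - f y| ≤ max N (M * δ ^ (ν - 1)) * dist x y) {x : Eu n} (hx : x ∉ S) (hxr : ‖x‖ < r) :
    ‖gradient f x‖ ≤ (N * (2 * r) ^ (1 - ν) + M * 2 ^ (1 - ν)) * infDist x S ^ (ν - 1) := by
  have hd : 0 < infDist x S := (hS.notMem_iff_infDist_pos hne).1 hx
  obtain ⟨s₀, hs₀⟩ := hne
  set d := infDist x S with hdd
  have hd2 : d ≤ 2 * r := by
    have h1 := infDist_le_dist_of_mem (x := x) hs₀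
    have h2 : ‖s₀‖ < r := by simpa using hr hs₀
    rw [dist_eq_norm] at h1
    linarith [norm_sub_le x s₀]
  have hr0 : 0 < 2 * r := hd.trans_le hd2
  have hball : ∀ y ∈ ball x (d / 2), d / 2 ≤ infDist y S := by
    intro y hy
    rw [mem_ball, dist_comm] at hy
    linarith [infDist_le_infDist_add_dist (s := S) (x := x) (y := y)]
  set L : ℝ≥0 := ⟨max N (M * (d / 2) ^ (ν - 1)), le_max_of_le_left hN⟩
  have hL : LipschitzOnWith L f (ball x (d / 2)) :=
    LipschitzOnWith.of_dist_le_mul fun y hy z hz =>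
      hf (d / 2) (half_pos hd) y z (hball y hy) (hball z hz)
  rw [norm_gradient]
  refine (norm_fderiv_le_of_lipschitzOn ℝ (ball_mem_nhds x (half_pos hd)) hL).trans ?_
  change max N (M * (d / 2) ^ (ν - 1)) ≤ _
  have h1 : (d / 2) ^ (ν - 1) = 2 ^ (1 - ν) * d ^ (ν - 1) := by
    rw [div_eq_mul_inv, Real.mul_rpow hd.le (by norm_num), Real.inv_rpow (by norm_num),
      ← Real.rpow_neg (by norm_num), neg_sub, mul_comm]
  have h2 : 1 ≤ (2 * r) ^ (1 - ν) * d ^ (ν - 1) := by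
    have h3 : (2 * r) ^ (ν - 1) ≤ d ^ (ν - 1) :=
      Real.rpow_le_rpow_of_nonpos hd hd2 (by linarith)
    calc (1 : ℝ) = (2 * r) ^ (1 - ν) * (2 * r) ^ (ν - 1) := by
          rw [← Real.rpow_add hr0]; simp
      _ ≤ _ := mul_le_mul_of_nonneg_left h3 (by positivity)
  have h4 : 0 ≤ (2 * r) ^ (1 - ν) * d ^ (ν - 1) := by positivity
  have h5 : 0 ≤ M * (2 ^ (1 - ν) * d ^ (ν - 1)) := by positivity
  rw [h1, add_mul, mul_assoc, mul_assoc]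
  refine max_le ?_ ?_
  · nlinarith [mul_le_mul_of_nonneg_left h2 hN]
  · nlinarith [mul_nonneg hN h4]

theorem diracOp_congr {n : ℕ} {u v : Eu n → Cl n} {x : Eu n} (h : u =ᶠ[𝓝 x] v) :
    diracOp u x = diracOp v x := by
  rw [diracOp, diracOp, h.fderiv_eq]

theorem diracOp_const_smul {n : ℕ} (a : ℝ) {u : Eu n → Cl n} {x : Eu n}
    (hu : DifferentiableAt ℝ u x) : diracOp (fun y => a • u y) x = a • diracOp u x := by
  rw [diracOp, diracOp, Finset.smul_sum, fderiv_fun_const_smul hu]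
  simp

/-- The jump problem for a real-valued Hölder function `g`: on the open set `U` bounded by `S`,
correct an extension `f` of `g` by the Cauchy transform of its gradient. -/
theorem exists_real_jump {n : ℕ} (hn : 2 ≤ n) {S U : Set (Eu n)} {r p : ℝ} (hS : IsCompact S)
    (hne : S.Nonempty) (hr : S ⊆ ball 0 r) (hU : IsOpen U) (hUS : Disjoint U S)
    (hUc : IsOpen (U ∪ S)ᶜ) {M ν : ℝ≥0} (hν0 : 0 < ν) (hν1 : ν ≤ 1) (hp : n * (1 - (ν : ℝ)) < p)
    (hI : marcinkiewiczIntegral S (U ∩ ball 0 r) p < ∞) {g : Eu n → ℝ} (hg : HolderOnWith M ν g S) :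
    ∃ (f : Eu n → ℝ) (W : Eu n → Cl n), Continuous f ∧ HasCompactSupport f ∧ Set.EqOn f g S ∧
      Continuous W ∧ Tendsto W (cocompact (Eu n)) (𝓝 0) ∧
      ∀ x ∉ S, ContDiffAt ℝ 1 (fun x => U.indicator f x • (1 : Cl n) + W x) x ∧
        diracOp (fun x => U.indicator f x • (1 : Cl n) + W x) x = 0 := by
  have hn' : (2 : ℝ) ≤ n := by exact_mod_cast hn
  have hν1' : (ν : ℝ) ≤ 1 := by exact_mod_cast hν1
  obtain ⟨f, N, r', hN, hr', hfc, hfg, hf0, hfL⟩ := exists_extension hS hne hr hν0 hν1 hg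
  -- an exponent `q > n` that is still admissible for the gradient of `f`
  obtain ⟨q, hq, hqp⟩ : ∃ q : ℝ, n < q ∧ q * (1 - (ν : ℝ)) ≤ p := by
    rcases hν1'.lt_or_eq with h | h
    · refine ⟨p / (1 - ν), ?_, (div_mul_cancel₀ p (by linarith)).le⟩
      rwa [lt_div_iff₀ (by linarith)]
    · exact ⟨n + 1, by linarith, by rw [h] at hp ⊢; linarith⟩
  have hgrad0 : ∀ x, r ≤ ‖x‖ → gradient f x = 0 := by
    intro x hx
    have h1 : f =ᶠ[𝓝 x] fun _ => 0 := by
      filter_upwards [continuous_norm.continuousAt.eventually (lt_mem_nhds (hr'.trans_le hx))]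
        with y hy using hf0 y hy.le
    rw [gradient, h1.fderiv_eq]
    simp
  have hden : IsDensity q r (U.indicator (gradient f)) := by
    have hr0 : 0 ≤ 2 * r := by
      obtain ⟨s, hs⟩ := hne
      have : ‖s‖ < r := by simpa using hr hs
      linarith [norm_nonneg s]
    exact isDensity_indicator_gradient hne hS.isClosed hr hU hUS (by linarith) hqp hI hgrad0
      (C := N * (2 * r) ^ (1 - (ν : ℝ)) + M * 2 ^ (1 - (ν : ℝ))) (by positivity)
      fun x hx hxr => norm_gradient_le_of_extension hne hS.isClosed hr hN M.2 hν1' hfL hx hxr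
  set h := U.indicator (gradient f) with hh
  set κ := cauchyMass n with hκ
  have hκ0 : 0 < κ := cauchyMass_pos hn
  have hTc := hden.continuous_cauchyTransform hn hq
  have hWc : Continuous fun x => κ⁻¹ • cauchyTransform n 0 h x := by fun_prop
  refine ⟨f, fun x => κ⁻¹ • cauchyTransform n 0 h x, hfc,
    HasCompactSupport.intro (isCompact_closedBall 0 r') fun x hx => hf0 x ?_, hfg,
    hWc, ?_, fun x₀ hx₀ => ?_⟩
  · simp only [mem_closedBall_zero_iff, not_le] at hx
    exact hx.le
  · simpa using (hden.tendsto_cauchyTransform_zero hn hq).const_smul κ⁻¹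
  have hd : 0 < infDist x₀ S := (hS.isClosed.notMem_iff_infDist_pos hne).1 hx₀
  -- near `x₀` the function `1_U f` is Lipschitz
  obtain ⟨δ, L, hδ, hL⟩ : ∃ (δ : ℝ) (L : ℝ≥0), 0 < δ ∧
      LipschitzOnWith L (U.indicator f) (ball x₀ δ) := by
    by_cases hxU : x₀ ∈ U
    · obtain ⟨δ, hδ, hδU⟩ := Metric.isOpen_iff.1 hU x₀ hxU
      refine ⟨min δ (infDist x₀ S / 2),
        ⟨max N (M * (infDist x₀ S / 2) ^ ((ν : ℝ) - 1)), le_max_of_le_left hN⟩,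
        lt_min hδ (half_pos hd), LipschitzOnWith.of_dist_le_mul fun y hy z hz => ?_⟩
      have hball : ∀ y ∈ ball x₀ (min δ (infDist x₀ S / 2)),
          y ∈ U ∧ infDist x₀ S / 2 ≤ infDist y S := by
        intro y hy
        refine ⟨hδU (ball_subset_ball (min_le_left _ _) hy), ?_⟩
        have hy' := ball_subset_ball (min_le_right _ _) hy
        rw [mem_ball, dist_comm] at hy'
        linarith [infDist_le_infDist_add_dist (s := S) (x := x₀) (y := y)]
      rw [Set.indicator_of_mem (hball y hy).1, Set.indicator_of_mem (hball z hz).1]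
      exact hfL _ (half_pos hd) y z (hball y hy).2 (hball z hz).2
    · obtain ⟨δ, hδ, hδU⟩ := Metric.isOpen_iff.1 hUc x₀ (by simp [hxU, hx₀])
      refine ⟨δ, 0, hδ, LipschitzOnWith.of_dist_le_mul fun y hy z hz => ?_⟩
      rw [Set.indicator_of_notMem fun h => hδU hy (Or.inl h),
        Set.indicator_of_notMem fun h => hδU hz (Or.inl h)]
      simp
  obtain ⟨φ, D, hφ, hφs, hφu⟩ := exists_lipschitzWith_eventuallyEq hδ hL
  obtain ⟨r₁, hφd⟩ := isDensity_gradient (q := q) (by linarith) hφ hφs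
  have hkd := hden.sub (by linarith) hφd
  -- near `x₀` the difference of the density and `∇φ` vanishes
  have hk0 : ∀ᶠ y in 𝓝 x₀, h y - gradient φ y = 0 := by
    have hSc : ∀ᶠ y in 𝓝 x₀, y ∉ S := hS.isClosed.isOpen_compl.mem_nhds hx₀
    filter_upwards [eventually_eventually_nhds.2 hφu, hSc] with y hy hyS
    rw [sub_eq_zero, gradient, EventuallyEq.fderiv_eq hy]
    by_cases hyU : y ∈ U
    · rw [hh, Set.indicator_of_mem hyU, gradient]
      congr 1
      refine EventuallyEq.fderiv_eq ?_
      filter_upwards [hU.mem_nhds hyU] with z hz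
      rw [Set.indicator_of_mem hz]
    · rw [hh, Set.indicator_of_notMem hyU]
      have : U.indicator f =ᶠ[𝓝 y] fun _ => 0 := by
        filter_upwards [hUc.mem_nhds (show y ∈ (U ∪ S)ᶜ by simp [hyU, hyS])] with z hz
        rw [Set.indicator_of_notMem fun h => hz (Or.inl h)]
      rw [this.fderiv_eq]
      simp
  obtain ⟨ρ, hρ, hρ0⟩ := Metric.eventually_nhds_iff_ball.1 hk0
  obtain ⟨hC1, hD0⟩ := contDiffAt_cauchyTransform_and_diracOp_eq_zero
    (hkd.integrable (by linarith)) hkd.eq_zero hρ hρ0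
  -- by the Cauchy–Pompeiu formula the solution is, near `x₀`, the transform of that difference
  have heq : (fun x => U.indicator f x • (1 : Cl n) + κ⁻¹ • cauchyTransform n 0 h x) =ᶠ[𝓝 x₀]
      fun x => κ⁻¹ • cauchyTransform n 0 (fun y => h y - gradient φ y) x := by
    filter_upwards [hφu] with x hx
    have h1 : cauchyTransform n 0 (fun y => h y - gradient φ y) x =
        cauchyTransform n 0 h x - cauchyTransform n 0 (gradient φ) x := by
      simp only [cauchyTransform, map_sub]
      exact integral_sub (hden.integrable_cauchyKernel hn hq le_rfl x)
        (hφd.integrable_cauchyKernel hn hq le_rfl x)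
    rw [h1, cauchyTransform_zero_gradient hn hφ hφs, hx, Algebra.algebraMap_eq_smul_one, neg_smul,
      sub_neg_eq_add, smul_add, smul_smul, inv_mul_cancel_left₀ hκ0.ne', add_comm]
  refine ⟨(hC1.const_smul κ⁻¹).congr_of_eventuallyEq heq, ?_⟩
  rw [diracOp_congr heq, diracOp_const_smul _ (hC1.differentiableAt (by norm_num)), hD0, smul_zero]

/-! ### The jump problem for Clifford-valued data -/

theorem abs_repr_le_norm {n : ℕ} (a : Cl n) (A : Finset (Fin n)) :
    |(bladeBasis n).repr a A| ≤ ‖a‖ := by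
  rw [norm_cl_eq, ← Real.sqrt_sq_eq_abs]
  exact Real.sqrt_le_sqrt (Finset.single_le_sum
    (f := fun A => ((bladeBasis n).repr a A) ^ 2) (fun _ _ => sq_nonneg _) (Finset.mem_univ A))

theorem HolderOnWith.repr_bladeBasis {n : ℕ} {S : Set (Eu n)} {M ν : ℝ≥0} {g : Eu n → Cl n}
    (hg : HolderOnWith M ν g S) (A : Finset (Fin n)) :
    HolderOnWith M ν (fun x => (bladeBasis n).repr (g x) A) S := by
  intro x hx y hy
  refine le_trans ?_ (hg x hx y hy)
  rw [edist_eq_enorm_sub, edist_eq_enorm_sub, enorm_le_iff_norm_le]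
  have h := abs_repr_le_norm (g x - g y) A
  rwa [map_sub, Finsupp.sub_apply] at h

theorem contDiffAt_mul_const_cl {n : ℕ} {u : Eu n → Cl n} {x : Eu n} (hu : ContDiffAt ℝ 1 u x)
    (b : Cl n) : ContDiffAt ℝ 1 (fun y => u y * b) x :=
  ((clMul n).flip b).contDiff.contDiffAt.comp x hu

theorem diracOp_mul_const {n : ℕ} {u : Eu n → Cl n} {x : Eu n} (hu : DifferentiableAt ℝ u x)
    (b : Cl n) : diracOp (fun y => u y * b) x = diracOp u x * b := by
  have h : HasFDerivAt (fun y => u y * b) (((clMul n).flip b).comp (fderiv ℝ u x)) x :=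
    ((clMul n).flip b).hasFDerivAt.comp x hu.hasFDerivAt
  rw [diracOp, diracOp, h.fderiv, Finset.sum_mul]
  simp [mul_assoc]

theorem diracOp_sum {n : ℕ} {ι : Type*} (s : Finset ι) {u : ι → Eu n → Cl n} {x : Eu n}
    (hu : ∀ i ∈ s, DifferentiableAt ℝ (u i) x) :
    diracOp (fun y => ∑ i ∈ s, u i y) x = ∑ i ∈ s, diracOp (u i) x := by
  simp only [diracOp]
  rw [fderiv_fun_sum hu, Finset.sum_comm]
  simp [Finset.mul_sum]

theorem HasCompactSupport.tendsto_cocompact {n : ℕ} {f : Eu n → ℝ} (hf : HasCompactSupport f) :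
    Tendsto f (cocompact (Eu n)) (𝓝 0) := by
  rw [hasCompactSupport_iff_eventuallyEq, coclosedCompact_eq_cocompact] at hf
  exact tendsto_const_nhds.congr' hf.symm

/-- The jump problem for Clifford-valued data follows coordinatewise, since right multiplication
by a constant preserves left monogenicity. -/
theorem exists_clifford_jump {n : ℕ} (hn : 2 ≤ n) {S U : Set (Eu n)} {r p : ℝ} (hS : IsCompact S)
    (hne : S.Nonempty) (hr : S ⊆ ball 0 r) (hU : IsOpen U) (hUS : Disjoint U S)
    (hUc : IsOpen (U ∪ S)ᶜ) {M ν : ℝ≥0} (hν0 : 0 < ν) (hν1 : ν ≤ 1) (hp : n * (1 - (ν : ℝ)) < p)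
    (hI : marcinkiewiczIntegral S (U ∩ ball 0 r) p < ∞) {g : Eu n → Cl n}
    (hg : HolderOnWith M ν g S) :
    ∃ F W : Eu n → Cl n, Continuous F ∧ Set.EqOn F g S ∧ Continuous W ∧
      Tendsto (fun x => U.indicator F x + W x) (cocompact (Eu n)) (𝓝 0) ∧
      ∀ x ∉ S, ContDiffAt ℝ 1 (fun x => U.indicator F x + W x) x ∧
        diracOp (fun x => U.indicator F x + W x) x = 0 := by
  choose f W hfc hfs hfg hWc hW0 hmono using fun A =>
    exists_real_jump hn hS hne hr hU hUS hUc hν0 hν1 hp hI (hg.repr_bladeBasis A)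
  set b := bladeBasis n
  have hmul : Continuous fun q : Cl n × Cl n => q.1 * q.2 := (clMul n).continuous₂
  have hWb : ∀ A, Continuous fun x => W A x * b A := fun A =>
    hmul.comp ((hWc A).prodMk continuous_const)
  have hF : Tendsto (fun x => ∑ A, f A x • b A) (cocompact (Eu n)) (𝓝 0) := by
    have := tendsto_finsetSum (Finset.univ : Finset (Finset (Fin n)))
      fun A _ => ((hfs A).tendsto_cocompact).smul_const (b A)
    simpa using this
  have hW : Tendsto (fun x => ∑ A, W A x * b A) (cocompact (Eu n)) (𝓝 0) := by
    have := tendsto_finsetSum (Finset.univ : Finset (Finset (Fin n)))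
      fun A _ => (((clMul n).flip (b A)).continuous.tendsto 0).comp (hW0 A)
    simpa using this
  have hsplit : (fun x => U.indicator (fun x => ∑ A, f A x • b A) x + ∑ A, W A x * b A) =
      fun x => ∑ A, (U.indicator (f A) x • (1 : Cl n) + W A x) * b A := by
    funext x
    by_cases hx : x ∈ U <;> simp [hx, add_mul, Finset.sum_add_distrib]
  refine ⟨fun x => ∑ A, f A x • b A, fun x => ∑ A, W A x * b A,
    continuous_finsetSum _ fun A _ => (hfc A).smul continuous_const, fun x hx => ?_,
    continuous_finsetSum _ fun A _ => hWb A, ?_, fun x hx => ?_⟩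
  · simp only [fun A => hfg A hx]
    exact b.sum_repr (g x)
  · have h1 : Tendsto (U.indicator fun x => ∑ A, f A x • b A) (cocompact (Eu n)) (𝓝 0) :=
      squeeze_zero_norm (fun x => norm_indicator_le_norm_self _ x) (by simpa using hF.norm)
    simpa using h1.add hW
  · rw [hsplit]
    have hd : ∀ A, DifferentiableAt ℝ (fun x => U.indicator (f A) x • (1 : Cl n) + W A x) x :=
      fun A => (hmono A x hx).1.differentiableAt (by norm_num)
    refine ⟨ContDiffAt.sum fun A _ => contDiffAt_mul_const_cl (hmono A x hx).1 (b A), ?_⟩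
    rw [diracOp_sum _ fun A _ =>
      (contDiffAt_mul_const_cl (hmono A x hx).1 (b A)).differentiableAt (by norm_num)]
    refine Finset.sum_eq_zero fun A _ => ?_
    rw [diracOp_mul_const (hd A), (hmono A x hx).2, zero_mul]

/-- A number `0 ≤ a < sup` is exceeded by an admissible exponent. Nonnegativity of `a` excludes the
value `0` that `sSup` takes on the empty set and on sets that are unbounded above. -/
theorem exists_lt_of_lt_marcinkiewiczSup {n : ℕ} {S D : Set (Eu n)} {a : ℝ} (ha : 0 ≤ a)
    (h : a < marcinkiewiczSup S D) : ∃ p, a < p ∧ marcinkiewiczIntegral S D p < ∞ := by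
  have hne : {p : ℝ | marcinkiewiczIntegral S D p < ∞}.Nonempty := by
    by_contra hempty
    rw [marcinkiewiczSup, Set.not_nonempty_iff_eq_empty.1 hempty, Real.sSup_empty] at h
    linarith
  obtain ⟨p, hp, hap⟩ := exists_lt_of_lt_csSup hne h
  exact ⟨p, hap, hp⟩

theorem isMonogenicOn_const_add_smul {n : ℕ} {S : Set (Eu n)} {Ψ : Eu n → Cl n}
    (h : ∀ x ∉ S, ContDiffAt ℝ 1 Ψ x ∧ diracOp Ψ x = 0) (c : Cl n) (σ : ℝ) :
    IsMonogenicOn (fun x => c + σ • Ψ x) Sᶜ := by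
  refine ⟨fun x hx => (contDiffAt_const.add ((h x hx).1.const_smul σ)).contDiffWithinAt,
    fun x hx => ?_⟩
  have h1 : diracOp (fun x => c + σ • Ψ x) x = diracOp (fun x => σ • Ψ x) x := by
    simp only [diracOp, fderiv_const_add]
  rw [h1, diracOp_const_smul σ ((h x hx).1.differentiableAt (by norm_num)), (h x hx).2, smul_zero]

theorem mainTheorem1 (n : ℕ) (hn : 2 ≤ n)
    (Ω S : Set (EuclideanSpace ℝ (Fin n))) (hΩ : IsJordanDomainWithBoundary Ω S)
    (r : ℝ) (hr : S ⊆ Metric.ball 0 r)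
    (ν : ℝ≥0) (hν0 : 0 < ν) (hν1 : ν ≤ 1)
    (g : EuclideanSpace ℝ (Fin n) → Cl n) (hg : ∃ M : ℝ≥0, HolderOnWith M ν g S)
    (hνm : 1 - marcinkiewiczExponent Ω S r / n < (ν : ℝ)) (c : Cl n) :
    ∃ Φ : EuclideanSpace ℝ (Fin n) → Cl n, IsJumpSolution Ω S g c Φ := by
  obtain ⟨M, hg⟩ := hg
  have hS := hΩ.hypersurface.isCompact
  rcases S.eq_empty_or_nonempty with hempty | hne
  · refine ⟨fun _ => c, ⟨contDiffOn_const, fun x _ => by simp [diracOp]⟩,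
      ⟨fun _ => c, fun _ => c, continuousOn_const, fun _ _ => rfl, continuousOn_const,
        fun _ _ => rfl, fun x hx => ?_⟩, tendsto_const_nhds⟩
    simp [hempty] at hx
  have hn0 : (0 : ℝ) < n := by
    have : 0 < n := by omega
    exact_mod_cast this
  have hν1' : (ν : ℝ) ≤ 1 := by exact_mod_cast hν1
  have ha : 0 ≤ n * (1 - (ν : ℝ)) := mul_nonneg hn0.le (by linarith)
  have hlt : n * (1 - (ν : ℝ)) < marcinkiewiczExponent Ω S r := by
    rw [← lt_div_iff₀' hn0]
    linarith
  have hdisj : Disjoint Ω S := by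
    rw [← hΩ.frontier_eq]
    exact (disjoint_frontier_iff_isOpen.2 hΩ.isOpen).symm
  have hcl : Ω ∪ S = closure Ω := by
    rw [closure_eq_self_union_frontier, hΩ.frontier_eq]
  have hext : IsOpen (Ω ∪ S)ᶜ := by
    rw [hcl]
    exact isClosed_closure.isOpen_compl
  -- the correction is made on the side of `S` that realizes the Marcinkiewicz exponent
  rcases lt_max_iff.1 hlt with h | h
  · obtain ⟨p, hp, hI⟩ := exists_lt_of_lt_marcinkiewiczSup ha h
    have hI' : marcinkiewiczIntegral S (Ω ∩ ball 0 r) p < ∞ :=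
      (lintegral_mono_set Set.inter_subset_left).trans_lt hI
    obtain ⟨F, W, hF, hFg, hW, h0, hmono⟩ := exists_clifford_jump hn hS hne hr hΩ.isOpen hdisj hext
      hν0 hν1 hp hI' hg
    refine ⟨fun x => c + (1 : ℝ) • (Ω.indicator F x + W x),
      isMonogenicOn_const_add_smul hmono c 1,
      ⟨fun x => c + (F x + W x), fun x => c + W x,
        (continuous_const.add (hF.add hW)).continuousOn, fun x hx => ?_,
        (continuous_const.add hW).continuousOn, fun x hx => ?_, fun x hx => ?_⟩, ?_⟩
    · simp [hx]
    · have hxΩ : x ∉ Ω := fun h => hx (Or.inl h)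
      simp [hxΩ]
    · simp only [← hFg hx]
      abel
    · simpa using h0.const_add c
  · obtain ⟨p, hp, hI⟩ := exists_lt_of_lt_marcinkiewiczSup ha h
    have hcompl : ((Ω ∪ S)ᶜ ∪ S)ᶜ = Ω := by
      ext x
      have : x ∈ Ω → x ∉ S := fun h => Set.disjoint_left.1 hdisj h
      simp only [Set.mem_compl_iff, Set.mem_union]
      tauto
    obtain ⟨F, W, hF, hFg, hW, h0, hmono⟩ := exists_clifford_jump hn hS hne hr hext
      (Set.disjoint_left.2 fun x hx hxS => hx (Or.inr hxS)) (hcompl.symm ▸ hΩ.isOpen)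
      hν0 hν1 hp hI hg
    refine ⟨fun x => c + (-1 : ℝ) • ((Ω ∪ S)ᶜ.indicator F x + W x),
      isMonogenicOn_const_add_smul hmono c (-1),
      ⟨fun x => c - W x, fun x => c - (F x + W x),
        (continuous_const.sub hW).continuousOn, fun x hx => ?_,
        (continuous_const.sub (hF.add hW)).continuousOn, fun x hx => ?_, fun x hx => ?_⟩, ?_⟩
    · simp [hx, sub_eq_add_neg]
    · simp only
      rw [Set.indicator_of_mem hx, neg_one_smul, sub_eq_add_neg]
    · simp only [← hFg hx]
      abel
    · simpa using (h0.const_smul (-1 : ℝ)).const_add c
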